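/- Setting. Let $(E_p,\mathcal E_p)_{p\ge 0}$ be measurable spaces, $x_0\in E_0$, $M_p$ ($p\ge1$) Markov kernels from $E_{p-1}$ to $E_p$, $B_p\in\mathcal E_p$ and $G_p=\mathbb 1_{B_p}$ ($p\ge1$). For $n\ge 1$ put $\gamma_n(\varphi)=\mathbb E_{x_0}[\prod_{p=1}^{n-1}G_p(X_p)\,\varphi(X_n)]$ for the Markov chain $(X_p)$ with kernels $M_p$ started at $x_0$, and $\eta_n(\varphi)=\gamma_n(\varphi)/\gamma_n(1)$; assume $\gamma_n(1)>0$ for all $n\ge 1$. Alive particle filter with parameter $N$. At time $1$ sample $x_1^1,x_1^2,\dots$ i.i.d. from $M_1(x_0,\cdot)$. At each time $p\ge 1$ let $T_p=\inf\{k\ge N:\sum_{i=1}^kG_p(x_p^i)\ge N\}$ and $\eta_p^{T_p}=\frac1{T_p-1}\sum_{i=1}^{T_p-1}\delta_{x_p^i}$, and sample $x_{p+1}^1,x_{p+1}^2,\dots$, conditionally i.i.d. given the past, from $\Phi_{p+1}(\eta_p^{T_p})$, where $\Phi_{p+1}(\mu)(\varphi)=\mu(G_pM_{p+1}(\varphi))/\mu(G_p)$.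 Put $\gamma_n^{T_n}(1)=\prod_{p=1}^{n-1}\frac{N-1}{T_p-1}$. Assumption $(\hat H_m)$, for some $m\ge1$. Let $\hat M_p(x,dy)=M_p(x,dy)G_p(y)/M_p(G_p)(x)$ and $\hat M_{p,p+m}=\hat M_{p+1}\cdots\hat M_{p+m}$. For each $p\ge 1$, $$\hat\delta_p:=\sup_{x,y\in B_p}\frac{M_{p+1}(G_{p+1})(x)}{M_{p+1}(G_{p+1})(y)}<\infty,$$ and there is $\hat\beta_p^{(m)}\in[1,\infty)$ with $\hat M_{p,p+m}(x,\cdot)\le\hat\beta_p^{(m)}\hat M_{p,p+m}(y,\cdot)$ for all $x,y\in B_p$. Put $\hat\delta_p^{(m)}=\prod_{q=p}^{p+m-1}\hat\delta_q$. Claim. Assume $(\hat H_m)$. Then for all $n\ge 2$ and $N\ge 3$, $$N>\sum_{s=1}^n\frac{\hat\delta_s^{(m)}\hat\beta_s^{(m)}}{\eta_s(G_s)}\ \Longrightarrow\ \mathbb E\Big[\Big(\frac{\gamma_n^{T_n}(1)}{\gamma_n(1)}-1\Big)^2\Big]\le\frac4N\sum_{s=1}^n\frac{\hat\delta_s^{(m)}\hat\beta_s^{(m)}}{\eta_s(G_s)}.$$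 Consequently, if $\hat\delta_s^{(m)}\hat\beta_s^{(m)}/\eta_s(G_s)\le c$ for all $s\ge1$, then for all $n\ge 2$ and $N\ge 3$ with $N>cn$ the relative variance on the left is at most $4$, uniformly in $n$. -/

import Mathlib

open MeasureTheory ProbabilityTheory
open scoped ENNReal

namespace AliveFilter

section Model

/-! Indices: `M p` is the Markov kernel from `E p` to `E (p + 1)` (usually written `M_{p+1}`),
`B p` is the set whose indicator is the potential `G_p` (only `p ≥ 1` is used), and `x₀ : E 0`
is the starting point. -/

variable {E : ℕ → Type*} [∀ p, MeasurableSpace (E p)]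
  (M : ∀ p, Kernel (E p) (E (p + 1))) (B : ∀ p, Set (E p)) (x₀ : E 0)

/-- The unnormalized Feynman-Kac marginal `γ_n`, for `n ≥ 1`:
`γ_n(φ) = ∫ M_1(x₀,dx_1) G_1(x_1) M_2(x_1,dx_2) ⋯ G_{n-1}(x_{n-1}) M_n(x_{n-1},dx_n) φ(x_n)`. -/
noncomputable def gamma : (n : ℕ) → Measure (E n)
  | 0 => Measure.dirac x₀
  | 1 => M 0 x₀
  | (n + 2) => ((gamma (n + 1)).restrict (B (n + 1))).bind (M (n + 1))

/-- The normalizing constant `γ_n(1)`. -/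
noncomputable def normConst (n : ℕ) : ℝ := (gamma M B x₀ n).real Set.univ

/-- The predictor `η_n = γ_n / γ_n(1)`. -/
noncomputable def eta (n : ℕ) : Measure (E n) :=
  (gamma M B x₀ n Set.univ)⁻¹ • gamma M B x₀ n

/-- `Φ_{p+1}(μ)(φ) = μ(G_p M_{p+1}(φ)) / μ(G_p)`. -/
noncomputable def Phi (p : ℕ) (μ : Measure (E p)) : Measure (E (p + 1)) :=
  (μ (B p))⁻¹ • (μ.restrict (B p)).bind (M p)

/-- The normalized kernel `M̂_{p+1}(x,dy) = M_{p+1}(x,dy) G_{p+1}(y) / M_{p+1}(G_{p+1})(x)`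
from `E p` to `E (p + 1)`. -/
noncomputable def hatM [∀ p, IsMarkovKernel (M p)] (p : ℕ) : Kernel (E p) (E (p + 1)) :=
  (M p).withDensity
    (fun x y => (B (p + 1)).indicator (fun _ => (1 : ℝ≥0∞)) y / M p x (B (p + 1)))

/-- The density above is measurable: `M̂_{p+1}(x,·)` is `M_{p+1}(x,·)` conditioned to `B_{p+1}`. -/
theorem hatM_apply [∀ p, IsMarkovKernel (M p)] (p : ℕ)
    (hB : MeasurableSet (B (p + 1))) (x : E p) :
    hatM M B p x = (M p x (B (p + 1)))⁻¹ • (M p x).restrict (B (p + 1)) := by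
  have h : Measurable (Function.uncurry fun (x : E p) (y : E (p + 1)) =>
      (B (p + 1)).indicator (fun _ => (1 : ℝ≥0∞)) y / M p x (B (p + 1))) :=
    ((measurable_const.indicator hB).comp measurable_snd).div
      (((M p).measurable_coe hB).comp measurable_fst)
  rw [hatM, Kernel.withDensity_apply _ h]
  have : (fun y => (B (p + 1)).indicator (fun _ => (1 : ℝ≥0∞)) y / M p x (B (p + 1))) =
    (M p x (B (p + 1)))⁻¹ • (B (p + 1)).indicator 1 := by
    ext y; simp [div_eq_mul_inv, mul_comm, Pi.one_def]
  rw [this, withDensity_smul _ (measurable_one.indicator hB), withDensity_indicator_one hB]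

/-- The composition `M̂_{p,p+m} = M̂_{p+1} M̂_{p+2} ⋯ M̂_{p+m}`. -/
noncomputable def hatMIter [∀ p, IsMarkovKernel (M p)] (p : ℕ) :
    (m : ℕ) → Kernel (E p) (E (p + m))
  | 0 => Kernel.id
  | (m + 1) => hatM M B (p + m) ∘ₖ hatMIter p m

/-- `δ̂_p = sup_{x, y ∈ B_p} M_{p+1}(G_{p+1})(x) / M_{p+1}(G_{p+1})(y)`, as an element of
`[0, ∞]` (a positive number divided by zero is `∞`). -/
noncomputable def hatDelta (p : ℕ) : ℝ≥0∞ :=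
  ⨆ x ∈ B p, ⨆ y ∈ B p, M p x (B (p + 1)) / M p y (B (p + 1))

/-- `δ̂_p^{(m)} = ∏_{q=p}^{p+m-1} δ̂_q`. -/
noncomputable def hatDeltaProd (m p : ℕ) : ℝ≥0∞ :=
  ∏ q ∈ Finset.Ico p (p + m), hatDelta M B q

/-- The condition `(Ĥ_m)` with constants `β̂_p^{(m)} = β p`. -/
structure HatH [∀ p, IsMarkovKernel (M p)] (m : ℕ) (β : ℕ → ℝ) : Prop where
  one_le_m : 1 ≤ m
  delta_lt_top : ∀ p, 1 ≤ p → hatDelta M B p < ∞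
  one_le_beta : ∀ p, 1 ≤ p → 1 ≤ β p
  mixing : ∀ p, 1 ≤ p → ∀ x ∈ B p, ∀ y ∈ B p,
    hatMIter M B p m x ≤ ENNReal.ofReal (β p) • hatMIter M B p m y

/-- The coefficient `δ̂_s^{(m)} β̂_s^{(m)} / η_s(G_s)`. -/
noncomputable def coeff (m : ℕ) (β : ℕ → ℝ) (s : ℕ) : ℝ :=
  (hatDeltaProd M B m s).toReal * β s / (eta M B x₀ s).real (B s)

end Model

section Filter

variable {E : ℕ → Type*}

open Classical in
/-- `T = inf {k ≥ N : ∑_{i=1}^k 𝟙_A(x^i) ≥ N}`, where `x i` is the `(i+1)`-st particle `x^{i+1}`.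
(The value is `0` if there is no such `k`.) -/
noncomputable def stopTime {F : Type*} (A : Set F) (N : ℕ) (x : ℕ → F) : ℕ :=
  sInf {k : ℕ | N ≤ k ∧ N ≤ ∑ i ∈ Finset.range k, if x i ∈ A then 1 else 0}

/-- The empirical measure `η^T = (T-1)⁻¹ ∑_{i=1}^{T-1} δ_{x^i}` of the particles before the last
one. -/
noncomputable def empirical {F : Type*} [MeasurableSpace F] (A : Set F) (N : ℕ) (x : ℕ → F) :
    Measure F :=
  ((stopTime A N x - 1 : ℕ) : ℝ≥0∞)⁻¹ •
    ∑ i ∈ Finset.range (stopTime A N x - 1), Measure.dirac (x i)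

variable [∀ p, MeasurableSpace (E p)]

/-- The σ-algebra generated by the particles at the times `1, …, p`. -/
@[reducible] def history {Ω : Type*} (X : ∀ p, ℕ → Ω → E p) (p : ℕ) : MeasurableSpace Ω :=
  ⨆ q ∈ Finset.Icc 1 p, ⨆ i : ℕ, MeasurableSpace.comap (X q i) inferInstance

/-- `X p i` is the `(i+1)`-st particle sampled at time `p ≥ 1` by the alive particle filter: at
time `1` the particles are i.i.d. from `M_1(x₀,·)`; at time `p + 1`, conditionally on the particles
up to time `p`, they are i.i.d. from `Φ_{p+1}(η_p^{T_p})`. Only the first `T_p` particles at time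
`p` matter, where `T_p` is the first time at which `N` of them are alive. -/
structure IsAliveFilter (M : ∀ p, Kernel (E p) (E (p + 1))) (B : ∀ p, Set (E p)) (x₀ : E 0)
    (N : ℕ) {Ω : Type*} [MeasurableSpace Ω] (P : Measure Ω) (X : ∀ p, ℕ → Ω → E p) : Prop where
  measurable : ∀ p, 1 ≤ p → ∀ i, Measurable (X p i)
  init : ∀ (k : ℕ) (A : ℕ → Set (E 1)), (∀ j, MeasurableSet (A j)) →
    P (⋂ j ∈ Finset.range k, X 1 j ⁻¹' A j) = ∏ j ∈ Finset.range k, M 0 x₀ (A j)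
  step : ∀ p, 1 ≤ p → ∀ S : Set Ω, MeasurableSet[history X p] S →
    ∀ (k : ℕ) (A : ℕ → Set (E (p + 1))), (∀ j, MeasurableSet (A j)) →
    P (S ∩ ⋂ j ∈ Finset.range k, X (p + 1) j ⁻¹' A j) =
      ∫⁻ ω in S, ∏ j ∈ Finset.range k,
        Phi M B p (empirical (B p) N (fun i => X p i ω)) (A j) ∂P

/-- The estimate `γ_n^{T_n}(1) = ∏_{p=1}^{n-1} (N-1)/(T_p-1)` of the normalizing constant. -/
noncomputable def normConstEst (B : ∀ p, Set (E p)) (N : ℕ) {Ω : Type*} (X : ∀ p, ℕ → Ω → E p)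
    (n : ℕ) (ω : Ω) : ℝ :=
  ∏ p ∈ Finset.Ico 1 n, ((N : ℝ) - 1) / ((stopTime (B p) N (fun i => X p i ω) : ℝ) - 1)

end Filter

end AliveFilter

/-! Write κ_p for the conditional law of the particles at time p+1 given the past, w_p for the
product of (N-1)/(T_q-1) over q ≤ p, and Q_k for survival over k steps (`survive`). Exactly N-1 of
the first T-1 particles are alive, so (N-1)/(T-1) is the empirical mass of B. This is also the
normalization in Φ; the two cancel, and almost surely w_{p+1} κ_{p+1}(Q_k) = w_p η_{p+1}^T(1_B
Q_{k+1}) (`ae_weight_succ_mul`). Only the first two moments of η^T under sampling stopped at the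
N-th success remain to be found.

Here T is negative binomial and, given T, the alive particles before the last are N-1 independent
draws from κ conditioned on B. Summing over their positions gives E η^T(1_B f) = κ(1_B f) and E
η^T(1_B f)² ≤ κ(B) κ(1_B f²)/(N-2) + κ(1_B f)². The first relation iterates to unbiasedness of the
estimate, so its relative variance is its normalized second moment minus 1. For the second, Q(x) ≤
C_p Q(y) on B_p with C_p = δ̂_p^{(m)} β̂_p^{(m)} (`survive_succ_le`), hence κ(B) κ(Q²) ≤ C_p κ(Q)²
and each time step costs a factor 1 + C_p/(N-2).

The relative variance is therefore at most ∏_{s<n} (1 + C_s/(N-2)) - 1. Since C_s ≥ 1, and C_s is at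
most the coefficient in the claim, `prod_one_add_div_sub_one_le` finishes the argument. -/

namespace AliveFilter

/-! ### Negative binomial series -/

section Series

theorem tsum_choose_mul_pow_sub (t : ℕ) {q q' : ℝ≥0∞} (hq : q ≠ 0) (hqq : q + q' = 1) :
    ∑' j : ℕ, (j.choose t : ℝ≥0∞) * q' ^ (j - t) = (q ^ (t + 1))⁻¹ := by
  have hq'1 : q' ≤ 1 := hqq ▸ le_add_self
  have hq1 : q ≤ 1 := hqq ▸ le_self_add
  have hq't : q' ≠ ∞ := ne_top_of_le_ne_top ENNReal.one_ne_top hq'1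
  have hqt : q ≠ ∞ := ne_top_of_le_ne_top ENNReal.one_ne_top hq1
  have hsum : q.toReal + q'.toReal = 1 := by
    rw [← ENNReal.toReal_add hqt hq't, hqq, ENNReal.toReal_one]
  have hpos : 0 < q.toReal := ENNReal.toReal_pos hq hqt
  have hnn : 0 ≤ q'.toReal := ENNReal.toReal_nonneg
  have h := hasSum_choose_mul_geometric_of_norm_lt_one (𝕜 := ℝ) t (r := q'.toReal)
    (by rw [Real.norm_of_nonneg hnn]; linarith)
  have hshift : ∑' j : ℕ, (j.choose t : ℝ≥0∞) * q' ^ (j - t) =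
      ∑' n : ℕ, ((n + t).choose t : ℝ≥0∞) * q' ^ n := by
    rw [← (add_left_injective t).tsum_eq (f := fun j : ℕ => (j.choose t : ℝ≥0∞) * q' ^ (j - t))]
    · simp
    · intro j hj
      by_contra hcon
      refine hj ?_
      have : j < t := by
        by_contra h
        exact hcon ⟨j - t, by simp only; omega⟩
      simp [Nat.choose_eq_zero_of_lt this]
  rw [hshift]
  have hterm : ∀ n : ℕ, ((n + t).choose t : ℝ≥0∞) * q' ^ n =
      ENNReal.ofReal (((n + t).choose t : ℝ) * q'.toReal ^ n) := fun n => by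
    rw [ENNReal.ofReal_mul (by positivity), ENNReal.ofReal_natCast, ENNReal.ofReal_pow hnn,
      ENNReal.ofReal_toReal hq't]
  simp_rw [hterm]
  rw [← ENNReal.ofReal_tsum_of_nonneg (fun n => by positivity) h.summable, h.tsum_eq,
    show 1 - q'.toReal = q.toReal by linarith, one_div, ENNReal.ofReal_inv_of_pos (by positivity),
    ENNReal.ofReal_pow hpos.le, ENNReal.ofReal_toReal hqt]

theorem inv_mul_choose_succ (j t : ℕ) :
    ((j + 1 : ℕ) : ℝ≥0∞)⁻¹ * ((j + 1).choose (t + 1) * (t + 1 : ℕ)) = j.choose t := by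
  have h : (((j + 1).choose (t + 1) * (t + 1) : ℕ) : ℝ≥0∞) = ((j + 1) * j.choose t : ℕ) := by
    rw [Nat.add_one_mul_choose_eq]
  rw [← Nat.cast_mul, h, Nat.cast_mul, ← mul_assoc, ENNReal.inv_mul_cancel (by simp) (by simp),
    one_mul]

/-- Up to a power of q this is E[(N-1)/(T-1)] = q with j = T-1: the absorption identity cancels 1/j
and lowers both binomial indices. At j = 0 the infinite inverse meets a zero binomial. -/
theorem tsum_inv_mul_choose (t : ℕ) {q q' : ℝ≥0∞} (hq : q ≠ 0) (hqq : q + q' = 1) :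
    ∑' j : ℕ, (j : ℝ≥0∞)⁻¹ * ((j.choose (t + 1) : ℝ≥0∞) * (t + 1 : ℕ) * q' ^ (j - (t + 1))) =
      (q ^ (t + 1))⁻¹ := by
  rw [tsum_eq_zero_add' ENNReal.summable, ← tsum_choose_mul_pow_sub t hq hqq]
  simp only [Nat.choose_zero_succ, Nat.cast_zero, zero_mul, mul_zero, zero_add]
  refine tsum_congr fun j => ?_
  rw [← mul_assoc, inv_mul_choose_succ, Nat.add_sub_add_right]

/-- One absorption removes one factor 1/j; after the shift the other, 1/(j+1), is enlarged to 1/j so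
that the first-order series applies. In effect (T-1)² is replaced by (T-1)(T-2). -/
theorem tsum_inv_sq_mul_choose_le (t : ℕ) {q q' : ℝ≥0∞} (hq : q ≠ 0) (hqq : q + q' = 1) :
    ∑' j : ℕ, (j : ℝ≥0∞)⁻¹ ^ 2 *
        ((j.choose (t + 2) : ℝ≥0∞) * ((t + 2 : ℕ) * (t + 1 : ℕ)) * q' ^ (j - (t + 2))) ≤
      (q ^ (t + 1))⁻¹ := by
  rw [← tsum_inv_mul_choose t hq hqq, tsum_eq_zero_add' ENNReal.summable]
  simp only [Nat.choose_zero_succ, Nat.cast_zero, zero_mul, mul_zero, zero_add]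
  refine ENNReal.tsum_le_tsum fun j => ?_
  have h := inv_mul_choose_succ j (t + 1)
  rw [Nat.add_sub_add_right]
  calc ((j + 1 : ℕ) : ℝ≥0∞)⁻¹ ^ 2 * (((j + 1).choose (t + 2) : ℝ≥0∞) *
        ((t + 2 : ℕ) * (t + 1 : ℕ)) * q' ^ (j - (t + 1)))
      = ((j + 1 : ℕ) : ℝ≥0∞)⁻¹ * ((((j + 1 : ℕ) : ℝ≥0∞)⁻¹ *
        ((j + 1).choose (t + 1 + 1) * (t + 1 + 1 : ℕ))) * (t + 1 : ℕ) * q' ^ (j - (t + 1))) := by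
        ring
    _ ≤ _ := by
        rw [h]
        gcongr
        simp

end Series

/-! ### Decomposition by the positions of the successes -/

section Stopping

variable {F : Type*}

open Classical in
/-- The sequences whose `(r + 1)`-st visit to `A` takes place at the index `j`. -/
def stopSet (A : Set F) (r j : ℕ) : Set (ℕ → F) :=
  {x | x j ∈ A ∧ ((Finset.range j).filter (fun i => x i ∈ A)).card = r}

/-- The constraint `N ≤ k` is automatic, as k draws contain at most k successes. A positive value
j+1 rules out the default 0 of an empty infimum. -/
theorem stopTime_eq_succ_iff (A : Set F) (r j : ℕ) (x : ℕ → F) :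
    stopTime A (r + 1) x = j + 1 ↔ x ∈ stopSet A r j := by
  classical
  set c : ℕ → ℕ := fun k => ((Finset.range k).filter (fun i => x i ∈ A)).card with hc
  have hmono : Monotone c := fun a b hab =>
    Finset.card_le_card (Finset.filter_subset_filter _ (Finset.range_mono hab))
  have hle : ∀ k, c k ≤ k := fun k => (Finset.card_filter_le _ _).trans (by simp)
  have hsucc : ∀ k, c (k + 1) = c k + if x k ∈ A then 1 else 0 := fun k => by
    simp only [hc, Finset.card_filter, Finset.sum_range_succ]
  have hst : stopTime A (r + 1) x = sInf {k | r + 1 ≤ c k} := by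
    unfold stopTime
    congr 1
    ext k
    simp only [Set.mem_ofPred_eq, hc, Finset.card_filter]
    refine ⟨fun h => ?_, fun h => ⟨?_, ?_⟩⟩
    · convert h.2
    · have := hle k
      simp only [hc, Finset.card_filter] at this
      omega
    · convert h
  rw [hst]
  simp only [stopSet, Set.mem_ofPred_eq]
  constructor
  · intro h
    have hne : {k | r + 1 ≤ c k}.Nonempty := by
      by_contra hcon
      rw [Set.not_nonempty_iff_eq_empty.1 hcon, Nat.sInf_empty] at h
      omega
    have h1 : r + 1 ≤ c (j + 1) := by
      have := Nat.sInf_mem hne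
      rwa [h] at this
    have h2 : ¬ r + 1 ≤ c j := Nat.notMem_of_lt_sInf (s := {k | r + 1 ≤ c k}) (by omega)
    have h3 := hsucc j
    split_ifs at h3 with hA
    · exact ⟨hA, by change c j = r; omega⟩
    · omega
  · rintro ⟨hA, hr⟩
    change c j = r at hr
    have h3 := hsucc j
    rw [if_pos hA] at h3
    refine le_antisymm (Nat.sInf_le (by simp only [Set.mem_ofPred_eq]; omega)) ?_
    refine le_csInf ⟨j + 1, by simp only [Set.mem_ofPred_eq]; omega⟩ fun k hk => ?_
    by_contra hlt
    have := hmono (show k ≤ j by omega)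
    simp only [Set.mem_ofPred_eq] at hk
    omega

/-- The indicator of `A` at the indices in `insert j s`, that of `Aᶜ` elsewhere. -/
noncomputable def pattern (A : Set F) (s : Finset ℕ) (j i : ℕ) : F → ℝ≥0∞ :=
  if i ∈ insert j s then A.indicator 1 else Aᶜ.indicator 1

open Classical in
theorem prod_pattern (A : Set F) {s : Finset ℕ} {j : ℕ} (hs : s ⊆ Finset.range j) (x : ℕ → F) :
    ∏ i ∈ Finset.range (j + 1), pattern A s j i (x i) =
      if x j ∈ A ∧ (Finset.range j).filter (fun i => x i ∈ A) = s then 1 else 0 := by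
  have hval : ∀ i, pattern A s j i (x i) = if (x i ∈ A ↔ i ∈ insert j s) then 1 else 0 := by
    intro i
    unfold pattern
    split_ifs with h1 h2 h2 <;> simp_all
  simp_rw [hval, Finset.prod_ite_zero, Finset.prod_const_one]
  congr 1
  apply propext
  constructor
  · intro h
    refine ⟨(h j (by simp)).2 (by simp), ?_⟩
    ext i
    simp only [Finset.mem_filter, Finset.mem_range]
    constructor
    · rintro ⟨hi, hA⟩
      have := (h i (by simp; omega)).1 hA
      rcases Finset.mem_insert.1 this with rfl | h'
      · omega
      · exact h'
    · intro hi
      have hij := Finset.mem_range.1 (hs hi)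
      exact ⟨hij, (h i (by simp; omega)).2 (Finset.mem_insert_of_mem hi)⟩
  · rintro ⟨hA, rfl⟩ i hi
    rcases Nat.lt_succ_iff_lt_or_eq.1 (Finset.mem_range.1 hi) with h | rfl
    · simp [h, h.ne]
    · simp [hA]

/-- Splitting according to the set s of success positions before j leaves products of functions of
single coordinates, with f and g inserted at a and b. Independence can integrate these. -/
theorem indicator_stopSet_mul_sum_mul_sum (A : Set F) (r j : ℕ) (f g : F → ℝ≥0∞) (x : ℕ → F) :
    (stopSet A r j).indicator 1 x * ((∑ a ∈ Finset.range j, A.indicator f (x a)) *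
        ∑ b ∈ Finset.range j, A.indicator g (x b)) =
      ∑ s ∈ (Finset.range j).powersetCard r, ∑ a ∈ s, ∑ b ∈ s,
        ∏ i ∈ Finset.range (j + 1), (pattern A s j i (x i) *
          ((if i = a then f (x i) else 1) * if i = b then g (x i) else 1)) := by
  classical
  set s₀ := (Finset.range j).filter (fun i => x i ∈ A) with hs₀
  have hsum : ∀ f : F → ℝ≥0∞, ∑ a ∈ Finset.range j, A.indicator f (x a) = ∑ a ∈ s₀, f (x a) := by
    intro f
    rw [hs₀, Finset.sum_filter]
    exact Finset.sum_congr rfl fun i _ => by simp [Set.indicator_apply]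
  have hterm : ∀ s ∈ (Finset.range j).powersetCard r,
      (∑ a ∈ s, ∑ b ∈ s, ∏ i ∈ Finset.range (j + 1), (pattern A s j i (x i) *
          ((if i = a then f (x i) else 1) * if i = b then g (x i) else 1))) =
        if s₀ = s then (if x j ∈ A then (∑ a ∈ s₀, f (x a)) * ∑ b ∈ s₀, g (x b) else 0) else 0 := by
    intro s hs
    have hsj := (Finset.mem_powersetCard.1 hs).1
    have hmem : ∀ a ∈ s, a ∈ Finset.range (j + 1) := fun a ha =>
      Finset.mem_range.2 ((Finset.mem_range.1 (hsj ha)).trans (Nat.lt_succ_self j))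
    have : ∀ a ∈ s, ∀ b ∈ s, ∏ i ∈ Finset.range (j + 1), (pattern A s j i (x i) *
          ((if i = a then f (x i) else 1) * if i = b then g (x i) else 1)) =
        (if x j ∈ A ∧ s₀ = s then 1 else 0) * (f (x a) * g (x b)) := by
      intro a ha b hb
      rw [Finset.prod_mul_distrib, Finset.prod_mul_distrib, prod_pattern A hsj,
        Finset.prod_ite_eq', Finset.prod_ite_eq', if_pos (hmem a ha), if_pos (hmem b hb)]
    rw [Finset.sum_congr rfl fun a ha => Finset.sum_congr rfl fun b hb => this a ha b hb]
    by_cases h1 : s₀ = s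
    · by_cases h2 : x j ∈ A
      · subst h1
        simp only [h2, and_self, if_true, one_mul, Finset.sum_mul_sum]
      · simp [h2]
    · simp [h1]
  rw [Finset.sum_congr rfl hterm, Finset.sum_ite_eq, hsum, hsum]
  by_cases hx : x ∈ stopSet A r j
  · have hx' : x j ∈ A ∧ s₀.card = r := by
      simp only [stopSet, Set.mem_ofPred_eq] at hx
      convert hx
    rw [Set.indicator_of_mem hx, if_pos, if_pos hx'.1, Pi.one_apply, one_mul]
    exact Finset.mem_powersetCard.2 ⟨Finset.filter_subset _ _, hx'.2⟩
  · rw [Set.indicator_of_notMem hx, zero_mul]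
    have hx' : ¬ (x j ∈ A ∧ s₀.card = r) := by
      simp only [stopSet, Set.mem_ofPred_eq] at hx
      convert hx
    split_ifs with h1 h2
    · exact absurd ⟨h2, (Finset.mem_powersetCard.1 h1).2⟩ hx'
    all_goals rfl

variable [MeasurableSpace F]

theorem measurable_pattern {A : Set F} (hA : MeasurableSet A) (s : Finset ℕ) (j i : ℕ) :
    Measurable (pattern A s j i) := by
  unfold pattern
  split_ifs
  · exact measurable_one.indicator hA
  · exact measurable_one.indicator hA.compl

/-- Each failure contributes μ(Aᶜ); each success, including the final one at j, contributes μ(A),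
except at a and b. On the diagonal a = b the two test functions meet in one integral. -/
theorem prod_lintegral_pattern (μ : Measure F) {A : Set F} (hA : MeasurableSet A)
    (f g : F → ℝ≥0∞) {s : Finset ℕ} {j : ℕ} (hs : s ⊆ Finset.range j) {a b : ℕ}
    (ha : a ∈ s) (hb : b ∈ s) :
    ∏ i ∈ Finset.range (j + 1), ∫⁻ y, pattern A s j i y *
        ((if i = a then f y else 1) * if i = b then g y else 1) ∂μ =
      μ Aᶜ ^ (j - s.card) * if a = b then μ A ^ s.card * ∫⁻ y in A, f y * g y ∂μ
        else μ A ^ (s.card - 1) * ((∫⁻ y in A, f y ∂μ) * ∫⁻ y in A, g y ∂μ) := by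
  obtain ⟨P, hP⟩ : ∃ P : ℕ → ℝ≥0∞, ∀ i, P i =
      ∫⁻ y in A, (if i = a then f y else 1) * (if i = b then g y else 1) ∂μ := ⟨_, fun _ => rfl⟩
  have hind : ∀ (C : Set F), MeasurableSet C → ∀ h : F → ℝ≥0∞,
      ∫⁻ y, C.indicator 1 y * h y ∂μ = ∫⁻ y in C, h y ∂μ := fun C hC h => by
    rw [← lintegral_indicator hC]
    refine lintegral_congr fun y => ?_
    by_cases hy : y ∈ C <;> simp [hy]
  have hj : j ∉ s := fun h => by simpa using hs h
  have hval : ∀ i, ∫⁻ y, pattern A s j i y *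
      ((if i = a then f y else 1) * if i = b then g y else 1) ∂μ =
        if i ∈ insert j s then P i else μ Aᶜ := by
    intro i
    by_cases h : i ∈ insert j s
    · simp only [pattern, if_pos h, hind A hA, hP]
    · have h1 : i ≠ a := fun hi => h (Finset.mem_insert_of_mem (hi ▸ ha))
      have h2 : i ≠ b := fun hi => h (Finset.mem_insert_of_mem (hi ▸ hb))
      simp only [pattern, if_neg h, if_neg h1, if_neg h2, mul_one]
      exact lintegral_indicator_one hA.compl
  have hsub : insert j s ⊆ Finset.range (j + 1) := by
    intro i hi
    rcases Finset.mem_insert.1 hi with rfl | h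
    · simp
    · have := Finset.mem_range.1 (hs h)
      simp; omega
  simp_rw [hval]
  rw [← Finset.prod_sdiff hsub, Finset.prod_congr rfl (g := fun _ => μ Aᶜ)
    (fun i hi => if_neg (Finset.mem_sdiff.1 hi).2), Finset.prod_const,
    Finset.prod_congr rfl (s₁ := insert j s) (g := P) (fun i hi => if_pos hi),
    Finset.prod_insert hj, Finset.card_sdiff_of_subset hsub, Finset.card_insert_of_notMem hj,
    Finset.card_range, Nat.add_sub_add_right]
  congr 1
  have hne : ∀ i, i ≠ a → i ≠ b → P i = μ A := fun i h1 h2 => by simp [hP, h1, h2]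
  have hPj : P j = μ A := hne j (fun h => hj (h ▸ ha)) (fun h => hj (h ▸ hb))
  have hcard : 1 ≤ s.card := Finset.card_pos.2 ⟨a, ha⟩
  rw [hPj, ← Finset.mul_prod_erase s P ha]
  split_ifs with hab
  · subst hab
    rw [Finset.prod_congr rfl (g := fun _ => μ A)
      (fun i hi => hne i (Finset.ne_of_mem_erase hi) (Finset.ne_of_mem_erase hi)),
      Finset.prod_const, Finset.card_erase_of_mem ha]
    have : P a = ∫⁻ y in A, f y * g y ∂μ := by simp [hP]
    rw [this]
    obtain ⟨k, hk⟩ := Nat.exists_eq_add_of_le' hcard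
    rw [hk, Nat.add_sub_cancel]
    ring
  · have hb' : b ∈ s.erase a := Finset.mem_erase.2 ⟨Ne.symm hab, hb⟩
    rw [← Finset.mul_prod_erase _ P hb', Finset.prod_congr rfl (g := fun _ => μ A)
      (fun i hi => hne i (Finset.ne_of_mem_erase (Finset.mem_of_mem_erase hi))
        (Finset.ne_of_mem_erase hi)),
      Finset.prod_const, Finset.card_erase_of_mem hb', Finset.card_erase_of_mem ha]
    have h1 : P a = ∫⁻ y in A, f y ∂μ := by simp [hP, hab]
    have h2 : P b = ∫⁻ y in A, g y ∂μ := by simp [hP, Ne.symm hab]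
    have h2c : 2 ≤ s.card := by
      have := Finset.card_pos.2 ⟨b, hb'⟩
      rw [Finset.card_erase_of_mem ha] at this
      omega
    rw [h1, h2]
    obtain ⟨k, hk⟩ := Nat.exists_eq_add_of_le' h2c
    rw [hk, show k + 2 - 1 - 1 = k by omega, show k + 2 - 1 = k + 1 by omega]
    ring

theorem sum_prod_lintegral_pattern (μ : Measure F) {A : Set F} (hA : MeasurableSet A)
    (f g : F → ℝ≥0∞) (r j : ℕ) :
    ∑ s ∈ (Finset.range j).powersetCard r, ∑ a ∈ s, ∑ b ∈ s,
        ∏ i ∈ Finset.range (j + 1), ∫⁻ y, pattern A s j i y *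
          ((if i = a then f y else 1) * if i = b then g y else 1) ∂μ =
      j.choose r * (μ Aᶜ ^ (j - r) * (r * (μ A ^ r * ∫⁻ y in A, f y * g y ∂μ) +
        r * (r - 1 : ℕ) * (μ A ^ (r - 1) * ((∫⁻ y in A, f y ∂μ) * ∫⁻ y in A, g y ∂μ)))) := by
  have hterm : ∀ s ∈ (Finset.range j).powersetCard r, (∑ a ∈ s, ∑ b ∈ s,
        ∏ i ∈ Finset.range (j + 1), ∫⁻ y, pattern A s j i y *
          ((if i = a then f y else 1) * if i = b then g y else 1) ∂μ) =
      (μ Aᶜ ^ (j - r) * (r * (μ A ^ r * ∫⁻ y in A, f y * g y ∂μ) +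
        r * (r - 1 : ℕ) * (μ A ^ (r - 1) * ((∫⁻ y in A, f y ∂μ) * ∫⁻ y in A, g y ∂μ)))) := by
    intro s hs
    obtain ⟨hsj, rfl⟩ := Finset.mem_powersetCard.1 hs
    rw [Finset.sum_congr rfl fun a ha => Finset.sum_congr rfl fun b hb =>
      prod_lintegral_pattern μ hA f g hsj ha hb]
    simp_rw [← Finset.mul_sum]
    congr 1
    have : ∀ a ∈ s, ∀ X Y : ℝ≥0∞, ∑ b ∈ s, (if a = b then X else Y) = X + (s.card - 1 : ℕ) * Y := by
      intro a ha X Y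
      rw [← Finset.add_sum_erase s _ ha, if_pos rfl, Finset.sum_congr rfl (g := fun _ => Y)
        (fun i hi => if_neg (Ne.symm (Finset.ne_of_mem_erase hi))), Finset.sum_const,
        Finset.card_erase_of_mem ha, nsmul_eq_mul]
    rw [Finset.sum_congr rfl fun a ha => this a ha _ _, Finset.sum_const, nsmul_eq_mul]
    ring
  rw [Finset.sum_congr rfl hterm, Finset.sum_const, Finset.card_powersetCard, Finset.card_range,
    nsmul_eq_mul]

end Stopping

/-! ### Conditionally i.i.d. sampling -/

section Sampling

variable {Ω F : Type*} [MeasurableSpace F]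

/-- Conditionally on `m`, the variables `X 0, X 1, …` are independent with law `κ`. -/
structure SampledFrom (m : MeasurableSpace Ω) [m0 : MeasurableSpace Ω] (P : Measure Ω)
    (κ : Ω → Measure F) (X : ℕ → Ω → F) : Prop where
  le : m ≤ m0
  measurable_law : Measurable[m] κ
  measurable : ∀ i, Measurable (X i)
  measure_inter : ∀ S, MeasurableSet[m] S → ∀ (k : ℕ) (A : ℕ → Set F),
    (∀ j, MeasurableSet (A j)) →
    P (S ∩ ⋂ j ∈ Finset.range k, X j ⁻¹' A j) = ∫⁻ ω in S, ∏ j ∈ Finset.range k, κ ω (A j) ∂P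

/-- The densities a and b define measures with the same restriction to m, and an m-measurable W sees
nothing else. -/
theorem lintegral_mul_eq_of_setLIntegral_eq {m : MeasurableSpace Ω} [m0 : MeasurableSpace Ω]
    (hm : m ≤ m0) {P : Measure Ω} {a b : Ω → ℝ≥0∞} (ha : Measurable a) (hb : Measurable b)
    (h : ∀ S, MeasurableSet[m] S → ∫⁻ ω in S, a ω ∂P = ∫⁻ ω in S, b ω ∂P)
    {W : Ω → ℝ≥0∞} (hW : Measurable[m] W) :
    ∫⁻ ω, W ω * a ω ∂P = ∫⁻ ω, W ω * b ω ∂P := by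
  have htrim : (P.withDensity a).trim hm = (P.withDensity b).trim hm := by
    refine @Measure.ext _ m _ _ fun S hS => ?_
    rw [trim_measurableSet_eq hm hS, trim_measurableSet_eq hm hS, withDensity_apply _ (hm _ hS),
      withDensity_apply _ (hm _ hS), h S hS]
  have key : ∀ c : Ω → ℝ≥0∞, Measurable c →
      ∫⁻ ω, W ω * c ω ∂P = ∫⁻ ω, W ω ∂((P.withDensity c).trim hm) := fun c hc => by
    rw [lintegral_trim hm hW, lintegral_withDensity_eq_lintegral_mul _ hc (hW.mono hm le_rfl)]
    exact lintegral_congr fun ω => mul_comm _ _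
  rw [key a ha, key b hb, htrim]

namespace SampledFrom

variable {m : MeasurableSpace Ω} [m0 : MeasurableSpace Ω] {P : Measure Ω}
  {κ : Ω → Measure F} {X : ℕ → Ω → F}

theorem measurable_lintegral (h : SampledFrom m P κ X) {f : F → ℝ≥0∞} (hf : Measurable f) :
    Measurable fun ω => ∫⁻ y, f y ∂κ ω :=
  (Measure.measurable_lintegral hf).comp (h.measurable_law.mono h.le le_rfl)

/-- Indicators are replaced by general functions one coordinate at a time, l counting those already
treated. With the other coordinates frozen, each side integrates `g l` against a measure on F, and
the induction hypothesis makes these two measures agree on every measurable set. -/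
theorem lintegral_mul_prod (h : SampledFrom m P κ X) {W : Ω → ℝ≥0∞} (hW : Measurable[m] W)
    (k : ℕ) {g : ℕ → F → ℝ≥0∞} (hg : ∀ i, Measurable (g i)) :
    ∫⁻ ω, W ω * ∏ i ∈ Finset.range k, g i (X i ω) ∂P =
      ∫⁻ ω, W ω * ∏ i ∈ Finset.range k, ∫⁻ y, g i y ∂κ ω ∂P := by
  have hW0 : Measurable W := hW.mono h.le le_rfl
  have hκ0 : Measurable κ := h.measurable_law.mono h.le le_rfl
  suffices H : ∀ l, l ≤ k → ∀ g : ℕ → F → ℝ≥0∞, (∀ i, Measurable (g i)) →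
      (∀ i, l ≤ i → ∃ C, MeasurableSet C ∧ g i = C.indicator 1) →
      ∫⁻ ω, W ω * ∏ i ∈ Finset.range k, g i (X i ω) ∂P =
        ∫⁻ ω, W ω * ∏ i ∈ Finset.range k, ∫⁻ y, g i y ∂κ ω ∂P by
    -- Beyond k the functions do not enter the products; they are reset so that the indicator
    -- condition holds there.
    have := H k le_rfl (fun i => if i < k then g i else Set.univ.indicator 1)
      (fun i => by split_ifs; exacts [hg i, measurable_one.indicator .univ])
      (fun i hi => ⟨Set.univ, .univ, if_neg (by omega)⟩)
    have e : ∀ i ∈ Finset.range k,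
        g i = if i < k then g i else Set.univ.indicator (1 : F → ℝ≥0∞) :=
      fun i hi => (if_pos (Finset.mem_range.1 hi)).symm
    refine (lintegral_congr fun ω => ?_).trans (this.trans (lintegral_congr fun ω => ?_))
    · exact congrArg (W ω * ·) (Finset.prod_congr rfl fun i hi => congrFun (e i hi) _)
    · exact congrArg (W ω * ·) (Finset.prod_congr rfl fun i hi =>
        congrArg (fun f : F → ℝ≥0∞ => ∫⁻ y, f y ∂κ ω) (e i hi).symm)
  intro l
  induction l with
  | zero =>
    intro _ g hg hC
    choose C hC hgC using fun i => hC i (Nat.zero_le i)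
    have hκC : ∀ i ω, ∫⁻ y, g i y ∂κ ω = κ ω (C i) := fun i ω => by
      rw [hgC i]; exact lintegral_indicator_one (hC i)
    refine lintegral_mul_eq_of_setLIntegral_eq h.le
      (Finset.measurable_prod _ fun i _ => (hg i).comp (h.measurable i))
      (Finset.measurable_prod _ fun i _ => h.measurable_lintegral (hg i)) (fun S hS => ?_) hW
    rw [lintegral_congr (f := fun ω => ∏ i ∈ Finset.range k, ∫⁻ y, g i y ∂κ ω) fun ω =>
      Finset.prod_congr rfl fun i _ => hκC i ω]
    rw [← h.measure_inter S hS k C hC, Set.inter_comm]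
    have hmeas : MeasurableSet (⋂ j ∈ Finset.range k, X j ⁻¹' C j) :=
      Finset.measurableSet_biInter _ fun i _ => h.measurable i (hC i)
    rw [← Measure.restrict_apply hmeas, ← lintegral_indicator_one hmeas]
    refine lintegral_congr fun ω => ?_
    classical
    have hval : ∀ i, (g i ∘ X i) ω = if ω ∈ X i ⁻¹' C i then 1 else 0 := fun i => by
      rw [hgC i]; rfl
    rw [Finset.prod_congr rfl fun i _ => hval i, Finset.prod_ite_zero]
    simp [Set.indicator_apply]
  | succ l ih =>
    intro hl g hg hC
    have hlk : l ∈ Finset.range k := Finset.mem_range.2 hl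
    set R : Ω → ℝ≥0∞ := fun ω => W ω * ∏ i ∈ (Finset.range k).erase l, g i (X i ω) with hR
    set R' : Ω → ℝ≥0∞ := fun ω => W ω * ∏ i ∈ (Finset.range k).erase l, ∫⁻ y, g i y ∂κ ω with hR'
    have hRm : Measurable R :=
      hW0.mul (Finset.measurable_prod _ fun i _ => (hg i).comp (h.measurable i))
    have hRm' : Measurable R' :=
      hW0.mul (Finset.measurable_prod _ fun i _ => h.measurable_lintegral (hg i))
    have h1 : ∀ φ : F → ℝ≥0∞, Measurable φ →
        ∫⁻ y, φ y ∂((P.withDensity R).map (X l)) = ∫⁻ ω, R ω * φ (X l ω) ∂P := fun φ hφ => by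
      rw [lintegral_map hφ (h.measurable l),
        lintegral_withDensity_eq_lintegral_mul _ hRm (g := fun ω => φ (X l ω))
          (hφ.comp (h.measurable l))]
      rfl
    have h2 : ∀ φ : F → ℝ≥0∞, Measurable φ →
        ∫⁻ y, φ y ∂((P.withDensity R').bind κ) = ∫⁻ ω, R' ω * ∫⁻ y, φ y ∂κ ω ∂P := fun φ hφ => by
      rw [Measure.lintegral_bind hκ0.aemeasurable hφ.aemeasurable,
        lintegral_withDensity_eq_lintegral_mul _ hRm' (h.measurable_lintegral hφ)]
      rfl
    have hprod : ∀ (φ : F → ℝ≥0∞) (T : ℕ → (F → ℝ≥0∞) → ℝ≥0∞),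
        ∏ i ∈ Finset.range k, T i (Function.update g l φ i) =
          (∏ i ∈ (Finset.range k).erase l, T i (g i)) * T l φ := fun φ T => by
      rw [← Finset.mul_prod_erase _ _ hlk, mul_comm, Function.update_self]
      congr 1
      exact Finset.prod_congr rfl fun i hi => by
        rw [Function.update_of_ne (Finset.ne_of_mem_erase hi)]
    have hν : (P.withDensity R).map (X l) = (P.withDensity R').bind κ := by
      ext C hCm
      have := ih (by omega) (Function.update g l (C.indicator 1))
        (fun i => by
          rcases eq_or_ne i l with rfl | hi
          · rw [Function.update_self]; exact measurable_one.indicator hCm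
          · rw [Function.update_of_ne hi]; exact hg i)
        (fun i hi => by
          rcases eq_or_ne i l with rfl | hi'
          · exact ⟨C, hCm, Function.update_self ..⟩
          · rw [Function.update_of_ne hi']; exact hC i (by omega))
      rw [← lintegral_indicator_one hCm, ← lintegral_indicator_one hCm]
      rw [h1 _ (measurable_one.indicator hCm), h2 _ (measurable_one.indicator hCm)]
      refine (lintegral_congr fun ω => ?_).trans (this.trans (lintegral_congr fun ω => ?_))
      · rw [hprod _ (fun i f => f (X i ω)), ← mul_assoc]
      · rw [hprod _ (fun i f => ∫⁻ y, f y ∂κ ω), ← mul_assoc]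
    have := h1 _ (hg l)
    rw [hν, h2 _ (hg l)] at this
    rw [lintegral_congr fun ω => ?_, ← this, lintegral_congr fun ω => ?_]
    · rw [hR', ← Finset.prod_erase_mul _ _ hlk, mul_assoc]
    · rw [hR, ← Finset.prod_erase_mul _ _ hlk, mul_assoc]

theorem lintegral_mul_indicator_stopSet (h : SampledFrom m P κ X) {W : Ω → ℝ≥0∞}
    (hW : Measurable[m] W) {A : Set F} (hA : MeasurableSet A) {f g : F → ℝ≥0∞}
    (hf : Measurable f) (hg : Measurable g) (r j : ℕ) :
    ∫⁻ ω, W ω * ((stopSet A r j).indicator 1 (fun i => X i ω) *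
        ((∑ a ∈ Finset.range j, A.indicator f (X a ω)) *
          ∑ b ∈ Finset.range j, A.indicator g (X b ω))) ∂P =
      ∫⁻ ω, W ω * (j.choose r * (κ ω Aᶜ ^ (j - r) * (r * (κ ω A ^ r * ∫⁻ y in A, f y * g y ∂κ ω) +
        r * (r - 1 : ℕ) * (κ ω A ^ (r - 1) *
          ((∫⁻ y in A, f y ∂κ ω) * ∫⁻ y in A, g y ∂κ ω))))) ∂P := by
  have hW0 : Measurable W := hW.mono h.le le_rfl
  have hmeas : ∀ s a b i, Measurable fun y => pattern A s j i y *
          ((if i = a then f y else 1) * if i = b then g y else 1) := fun s a b i => by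
    refine (measurable_pattern hA s j i).mul (.mul ?_ ?_) <;> split_ifs <;>
      first | assumption | exact measurable_const
  have e1 := fun ω => indicator_stopSet_mul_sum_mul_sum A r j f g (fun i => X i ω)
  simp_rw [e1, ← sum_prod_lintegral_pattern _ hA, Finset.mul_sum]
  have m1 : ∀ s a b, Measurable fun ω => W ω * ∏ i ∈ Finset.range (j + 1),
      (pattern A s j i (X i ω) *
          ((if i = a then f (X i ω) else 1) * if i = b then g (X i ω) else 1)) := fun s a b =>
    hW0.mul (Finset.measurable_prod _ fun i _ => (hmeas s a b i).comp (h.measurable i))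
  have m2 : ∀ s a b, Measurable fun ω => W ω * ∏ i ∈ Finset.range (j + 1),
      ∫⁻ y, (pattern A s j i y *
          ((if i = a then f y else 1) * if i = b then g y else 1)) ∂κ ω := fun s a b =>
    hW0.mul (Finset.measurable_prod _ fun i _ => h.measurable_lintegral (hmeas s a b i))
  have step : ∀ H : Finset ℕ → ℕ → ℕ → Ω → ℝ≥0∞, (∀ s a b, Measurable (H s a b)) →
      ∫⁻ ω, ∑ s ∈ (Finset.range j).powersetCard r, ∑ a ∈ s, ∑ b ∈ s, H s a b ω ∂P =
        ∑ s ∈ (Finset.range j).powersetCard r, ∑ a ∈ s, ∑ b ∈ s, ∫⁻ ω, H s a b ω ∂P := by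
    intro H hH
    rw [lintegral_finsetSum _ fun s _ => Finset.measurable_sum _ fun a _ =>
      Finset.measurable_sum _ fun b _ => hH s a b]
    refine Finset.sum_congr rfl fun s _ => ?_
    rw [lintegral_finsetSum _ fun a _ => Finset.measurable_sum _ fun b _ => hH s a b]
    refine Finset.sum_congr rfl fun a _ => ?_
    rw [lintegral_finsetSum _ fun b _ => hH s a b]
  rw [step _ m1, step _ m2]
  exact Finset.sum_congr rfl fun s _ => Finset.sum_congr rfl fun a _ =>
    Finset.sum_congr rfl fun b _ => h.lintegral_mul_prod hW _ (hmeas s a b)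

end SampledFrom

end Sampling

/-! ### The stopped empirical measure as a series over the stopping index -/

section Empirical

variable {F : Type*}

theorem tsum_indicator_stopSet {A : Set F} {r j : ℕ} {x : ℕ → F} (hx : x ∈ stopSet A r j)
    (Φ : ℕ → ℝ≥0∞) : ∑' i, (stopSet A r i).indicator 1 x * Φ i = Φ j := by
  rw [tsum_eq_single j, Set.indicator_of_mem hx, Pi.one_apply, one_mul]
  intro i hi
  rw [Set.indicator_of_notMem, zero_mul]
  intro hxi
  have h1 := (stopTime_eq_succ_iff A r j x).2 hx
  have h2 := (stopTime_eq_succ_iff A r i x).2 hxi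
  omega

theorem tsum_indicator_stopSet_of_eq_zero {A : Set F} {r : ℕ} {x : ℕ → F}
    (hx : stopTime A (r + 1) x = 0) (Φ : ℕ → ℝ≥0∞) :
    ∑' i, (stopSet A r i).indicator 1 x * Φ i = 0 := by
  refine ENNReal.tsum_eq_zero.2 fun i => ?_
  rw [Set.indicator_of_notMem, zero_mul]
  intro hxi
  have h2 := (stopTime_eq_succ_iff A r i x).2 hxi
  omega

theorem sum_indicator_one_of_mem_stopSet {A : Set F} {r j : ℕ} {x : ℕ → F}
    (hx : x ∈ stopSet A r j) : ∑ a ∈ Finset.range j, A.indicator (1 : F → ℝ≥0∞) (x a) = r := by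
  classical
  have h2 : ((Finset.range j).filter (fun i => x i ∈ A)).card = r := by
    simp only [stopSet, Set.mem_ofPred_eq] at hx
    convert hx.2
  rw [← h2, Finset.card_filter]
  push_cast
  exact Finset.sum_congr rfl fun i _ => by simp [Set.indicator_apply]

variable [MeasurableSpace F]

theorem setLIntegral_empirical {A : Set F} (hA : MeasurableSet A) {r j : ℕ} {x : ℕ → F}
    (hx : x ∈ stopSet A r j) {f : F → ℝ≥0∞} (hf : Measurable f) :
    ∫⁻ y in A, f y ∂empirical A (r + 1) x =
      (j : ℝ≥0∞)⁻¹ * ∑ a ∈ Finset.range j, A.indicator f (x a) := by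
  rw [← lintegral_indicator hA, empirical, (stopTime_eq_succ_iff A r j x).2 hx, lintegral_smul_measure,
    lintegral_finsetSum_measure]
  simp only [Nat.add_sub_cancel, smul_eq_mul]
  congr 1
  exact Finset.sum_congr rfl fun i _ => lintegral_dirac' _ (hf.indicator hA)

theorem empirical_apply {A : Set F} (hA : MeasurableSet A) {r j : ℕ} {x : ℕ → F}
    (hx : x ∈ stopSet A r j) : empirical A (r + 1) x A = (j : ℝ≥0∞)⁻¹ * r := by
  rw [← sum_indicator_one_of_mem_stopSet hx, ← setLIntegral_empirical hA hx measurable_one]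
  simp

/-- At most one term is nonzero. When the stopping time takes its default 0, the empirical measure
is zero and so is the series; this needs k ≠ 0. -/
theorem setLIntegral_empirical_pow (k : ℕ) (hk : k ≠ 0) {A : Set F} (hA : MeasurableSet A) (r : ℕ)
    (x : ℕ → F) {f : F → ℝ≥0∞} (hf : Measurable f) :
    (∫⁻ y in A, f y ∂empirical A (r + 1) x) ^ k =
      ∑' j : ℕ, (stopSet A r j).indicator 1 x *
        ((j : ℝ≥0∞)⁻¹ * ∑ a ∈ Finset.range j, A.indicator f (x a)) ^ k := by
  rcases Nat.eq_zero_or_eq_succ_pred (stopTime A (r + 1) x) with h | h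
  · rw [tsum_indicator_stopSet_of_eq_zero h, empirical, h]
    simp [hk]
  · have hx := (stopTime_eq_succ_iff A r _ x).1 h
    rw [tsum_indicator_stopSet hx, setLIntegral_empirical hA hx hf]

theorem measurableSet_stopSet {A : Set F} (hA : MeasurableSet A) (r j : ℕ) :
    MeasurableSet (stopSet A r j) := by
  classical
  have h : stopSet A r j = (fun x : ℕ → F => x j) ⁻¹' A ∩
      (fun x : ℕ → F => ∑ i ∈ Finset.range j, if x i ∈ A then 1 else 0) ⁻¹' {r} := by
    ext x
    simp only [stopSet, Set.mem_ofPred_eq, Set.mem_inter_iff, Set.mem_preimage,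
      Set.mem_singleton_iff, ← Finset.card_filter]
  rw [h]
  refine (measurable_pi_apply j hA).inter ?_
  refine measurableSet_preimage (Finset.measurable_sum _ fun i _ => ?_) (measurableSet_singleton r)
  exact Measurable.ite (measurable_pi_apply i hA) measurable_const measurable_const

theorem measurable_stopTime {A : Set F} (hA : MeasurableSet A) (r : ℕ) :
    Measurable (stopTime A (r + 1)) := by
  have hsucc : ∀ j : ℕ, MeasurableSet (stopTime A (r + 1) ⁻¹' {j + 1}) := fun j => by
    convert measurableSet_stopSet hA r j using 1
    ext x
    exact stopTime_eq_succ_iff A r j x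
  refine measurable_to_countable' fun k => ?_
  cases k with
  | succ j => exact hsucc j
  | zero =>
    have : stopTime A (r + 1) ⁻¹' {0} = (⋃ j : ℕ, stopTime A (r + 1) ⁻¹' {j + 1})ᶜ := by
      ext x
      simp only [Set.mem_preimage, Set.mem_singleton_iff, Set.mem_compl_iff, Set.mem_iUnion,
        not_exists]
      constructor
      · intro h j; omega
      · intro h
        by_contra hne
        exact h (stopTime A (r + 1) x - 1) (by omega)
    rw [this]
    exact (MeasurableSet.iUnion hsucc).compl

theorem measurable_setLIntegral_empirical {A : Set F} (hA : MeasurableSet A) (r : ℕ)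
    {f : F → ℝ≥0∞} (hf : Measurable f) :
    Measurable fun x => ∫⁻ y in A, f y ∂empirical A (r + 1) x := by
  have h := fun x => setLIntegral_empirical_pow 1 one_ne_zero hA r x hf
  simp only [pow_one] at h
  simp_rw [h]
  refine Measurable.tsum fun j => ?_
  exact (measurable_one.indicator (measurableSet_stopSet hA r j)).mul
    (measurable_const.mul (Finset.measurable_sum _ fun i _ =>
      (hf.indicator hA).comp (measurable_pi_apply i)))

end Empirical

/-! ### Moments of the stopped empirical measure -/

namespace SampledFrom

variable {Ω F : Type*} [MeasurableSpace F] {m : MeasurableSpace Ω} [m0 : MeasurableSpace Ω]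
  {P : Measure Ω} {κ : Ω → Measure F} {X : ℕ → Ω → F}

theorem measurable_coord (h : SampledFrom m P κ X) : Measurable fun ω i => X i ω :=
  measurable_pi_lambda _ h.measurable

theorem measurable_indicator_stopSet (h : SampledFrom m P κ X) {A : Set F}
    (hA : MeasurableSet A) (r j : ℕ) :
    Measurable fun ω => (stopSet A r j).indicator (1 : (ℕ → F) → ℝ≥0∞) (fun i => X i ω) :=
  (measurable_one.indicator (measurableSet_stopSet hA r j)).comp h.measurable_coord

theorem measurable_sum_indicator (h : SampledFrom m P κ X) {A : Set F}
    (hA : MeasurableSet A) {f : F → ℝ≥0∞} (hf : Measurable f) (j : ℕ) :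
    Measurable fun ω => ∑ a ∈ Finset.range j, A.indicator f (X a ω) :=
  Finset.measurable_sum _ fun i _ => (hf.indicator hA).comp (h.measurable i)

theorem measurable_choose_mul (h : SampledFrom m P κ X) {A : Set F}
    (hA : MeasurableSet A) {f g : F → ℝ≥0∞} (hf : Measurable f) (hg : Measurable g) (r j : ℕ) :
    Measurable fun ω => (j.choose r * (κ ω Aᶜ ^ (j - r) *
      (r * (κ ω A ^ r * ∫⁻ y in A, f y * g y ∂κ ω) + r * (r - 1 : ℕ) * (κ ω A ^ (r - 1) *
          ((∫⁻ y in A, f y ∂κ ω) * ∫⁻ y in A, g y ∂κ ω)))) : ℝ≥0∞) := by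
  have hκ0 : Measurable κ := h.measurable_law.mono h.le le_rfl
  have h1 : ∀ C, MeasurableSet C → Measurable fun ω => κ ω C := fun C hC =>
    (Measure.measurable_coe hC).comp hκ0
  have h2 : ∀ f : F → ℝ≥0∞, Measurable f → Measurable fun ω => ∫⁻ y in A, f y ∂κ ω :=
    fun f hf => by
      simp_rw [← lintegral_indicator hA]
      exact h.measurable_lintegral (hf.indicator hA)
  have := h1 _ hA
  have := h1 _ hA.compl
  have := h2 _ hf
  have := h2 _ hg
  have := h2 _ (hf.mul hg)
  fun_prop

theorem lintegral_mul_tsum (h : SampledFrom m P κ X) {W : Ω → ℝ≥0∞} (hW : Measurable[m] W)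
    {A : Set F} (hA : MeasurableSet A) {f g : F → ℝ≥0∞} (hf : Measurable f) (hg : Measurable g)
    (r : ℕ) (c : ℕ → ℝ≥0∞) :
    ∫⁻ ω, W ω * ∑' j, c j * ((stopSet A r j).indicator 1 (fun i => X i ω) *
        ((∑ a ∈ Finset.range j, A.indicator f (X a ω)) *
          ∑ b ∈ Finset.range j, A.indicator g (X b ω))) ∂P =
      ∫⁻ ω, W ω * ∑' j, c j * (j.choose r * (κ ω Aᶜ ^ (j - r) *
        (r * (κ ω A ^ r * ∫⁻ y in A, f y * g y ∂κ ω) + r * (r - 1 : ℕ) * (κ ω A ^ (r - 1) *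
          ((∫⁻ y in A, f y ∂κ ω) * ∫⁻ y in A, g y ∂κ ω))))) ∂P := by
  have hW0 : Measurable W := hW.mono h.le le_rfl
  have m1 : ∀ j, Measurable fun ω => W ω * ((stopSet A r j).indicator 1 (fun i => X i ω) *
        ((∑ a ∈ Finset.range j, A.indicator f (X a ω)) *
          ∑ b ∈ Finset.range j, A.indicator g (X b ω))) := fun j =>
    hW0.mul ((h.measurable_indicator_stopSet hA r j).mul
      ((h.measurable_sum_indicator hA hf j).mul (h.measurable_sum_indicator hA hg j)))
  have m2 : ∀ j, Measurable fun ω => W ω * (j.choose r * (κ ω Aᶜ ^ (j - r) *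
        (r * (κ ω A ^ r * ∫⁻ y in A, f y * g y ∂κ ω) + r * (r - 1 : ℕ) * (κ ω A ^ (r - 1) *
          ((∫⁻ y in A, f y ∂κ ω) * ∫⁻ y in A, g y ∂κ ω))))) := fun j =>
    hW0.mul (h.measurable_choose_mul hA hf hg r j)
  simp_rw [← ENNReal.tsum_mul_left, mul_left_comm (W _) (c _)]
  rw [lintegral_tsum fun j => ((m1 j).const_mul (c j)).aemeasurable,
    lintegral_tsum fun j => ((m2 j).const_mul (c j)).aemeasurable]
  refine tsum_congr fun j => ?_
  rw [lintegral_const_mul _ (m1 j), lintegral_const_mul _ (m2 j),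
    h.lintegral_mul_indicator_stopSet hW hA hf hg]

variable {A : Set F}

/-- For f = g = 1 both inner sums equal t+1 on the stopping event, so with weight (t+1)⁻² the series
is the indicator that stopping occurs. Its integral is the total negative binomial mass, which is 1.
-/
theorem ae_stopTime_ne_zero [IsProbabilityMeasure P] (h : SampledFrom m P κ X) (hA : MeasurableSet A) (t : ℕ)
    (hκ : ∀ᵐ ω ∂P, κ ω A ≠ 0 ∧ κ ω A + κ ω Aᶜ = 1) :
    ∀ᵐ ω ∂P, stopTime A (t + 2) (fun i => X i ω) ≠ 0 := by
  have key := h.lintegral_mul_tsum (W := 1) (@measurable_one _ _ _ m _) hA measurable_one measurable_one (t + 1)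
    fun _ => (((t + 1 : ℕ) : ℝ≥0∞)⁻¹) ^ 2
  have ht : ((t + 1 : ℕ) : ℝ≥0∞)⁻¹ * (t + 1 : ℕ) = 1 := ENNReal.inv_mul_cancel (by simp) (by simp)
  have hr : ∫⁻ ω, (1 : Ω → ℝ≥0∞) ω * ∑' j : ℕ, (((t + 1 : ℕ) : ℝ≥0∞)⁻¹) ^ 2 *
      (j.choose (t + 1) * (κ ω Aᶜ ^ (j - (t + 1)) *
        ((t + 1 : ℕ) * (κ ω A ^ (t + 1) * ∫⁻ y in A, (1 : F → ℝ≥0∞) y * (1 : F → ℝ≥0∞) y ∂κ ω) +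
        (t + 1 : ℕ) * (t + 1 - 1 : ℕ) * (κ ω A ^ (t + 1 - 1) *
          ((∫⁻ y in A, (1 : F → ℝ≥0∞) y ∂κ ω) * ∫⁻ y in A, (1 : F → ℝ≥0∞) y ∂κ ω))))) ∂P = 1 := by
    rw [lintegral_congr_ae (g := fun _ => 1), lintegral_one, measure_univ]
    filter_upwards [hκ] with ω hω
    have hq : κ ω A ≠ ∞ := ne_top_of_le_ne_top ENNReal.one_ne_top (hω.2 ▸ le_self_add)
    have hpow : κ ω A ^ (t + 1 + 1) ≠ ∞ := ENNReal.pow_ne_top hq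
    have : ∀ j : ℕ, (((t + 1 : ℕ) : ℝ≥0∞)⁻¹) ^ 2 *
      (j.choose (t + 1) * (κ ω Aᶜ ^ (j - (t + 1)) *
        ((t + 1 : ℕ) * (κ ω A ^ (t + 1) * ∫⁻ y in A, (1 : F → ℝ≥0∞) y * (1 : F → ℝ≥0∞) y ∂κ ω) +
        (t + 1 : ℕ) * (t + 1 - 1 : ℕ) * (κ ω A ^ (t + 1 - 1) *
          ((∫⁻ y in A, (1 : F → ℝ≥0∞) y ∂κ ω) * ∫⁻ y in A, (1 : F → ℝ≥0∞) y ∂κ ω))))) =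
        (j.choose (t + 1) * κ ω Aᶜ ^ (j - (t + 1))) * κ ω A ^ (t + 1 + 1) := by
      intro j
      simp only [Pi.one_apply, mul_one, lintegral_const, Measure.restrict_apply_univ, one_mul,
        Nat.add_sub_cancel]
      calc _ = (((t + 1 : ℕ) : ℝ≥0∞)⁻¹ * (t + 1 : ℕ)) ^ 2 *
            ((j.choose (t + 1) * κ ω Aᶜ ^ (j - (t + 1))) * κ ω A ^ (t + 1 + 1)) := by
              push_cast; ring
        _ = _ := by rw [ht]; simp
    simp_rw [this]
    rw [ENNReal.tsum_mul_right, tsum_choose_mul_pow_sub _ hω.1 hω.2, Pi.one_apply, one_mul,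
      ENNReal.inv_mul_cancel (pow_ne_zero _ hω.1) hpow]
  have hl : ∀ ω, (1 : Ω → ℝ≥0∞) ω * ∑' j : ℕ, (((t + 1 : ℕ) : ℝ≥0∞)⁻¹) ^ 2 *
      ((stopSet A (t + 1) j).indicator 1 (fun i => X i ω) *
        ((∑ a ∈ Finset.range j, A.indicator (1 : F → ℝ≥0∞) (X a ω)) *
          ∑ b ∈ Finset.range j, A.indicator (1 : F → ℝ≥0∞) (X b ω))) =
      ({ω | stopTime A (t + 2) (fun i => X i ω) ≠ 0} : Set Ω).indicator 1 ω := by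
    intro ω
    rw [Pi.one_apply, one_mul]
    simp_rw [mul_left_comm ((((t + 1 : ℕ) : ℝ≥0∞)⁻¹) ^ 2)]
    rcases Nat.eq_zero_or_eq_succ_pred (stopTime A (t + 1 + 1) fun i => X i ω) with h0 | h0
    · rw [tsum_indicator_stopSet_of_eq_zero h0, Set.indicator_of_notMem (by simpa using h0)]
    · have hx := (stopTime_eq_succ_iff A (t + 1) _ _).1 h0
      rw [tsum_indicator_stopSet hx, sum_indicator_one_of_mem_stopSet hx,
        Set.indicator_of_mem (h0.trans_ne (Nat.succ_ne_zero _)), Pi.one_apply]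
      calc _ = (((t + 1 : ℕ) : ℝ≥0∞)⁻¹ * (t + 1 : ℕ)) ^ 2 := by ring
        _ = 1 := by rw [ht, one_pow]
  have hmeas : MeasurableSet {ω | stopTime A (t + 2) (fun i => X i ω) ≠ 0} :=
    (((measurable_stopTime hA (t + 1)).comp h.measurable_coord) (measurableSet_singleton 0)).compl
  rw [hr, lintegral_congr hl, lintegral_indicator_one hmeas] at key
  exact (prob_compl_eq_zero_iff hmeas).2 key

/-- The choice g = 1 inserts the number r = t+1 of earlier successes, compensated by (t+1)⁻¹. The r
diagonal and r(r-1) off-diagonal terms then coincide and add up to r². -/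
theorem lintegral_mul_setLIntegral_empirical (h : SampledFrom m P κ X) (hA : MeasurableSet A)
    (t : ℕ) (hκ : ∀ᵐ ω ∂P, κ ω A ≠ 0 ∧ κ ω A + κ ω Aᶜ = 1) {W : Ω → ℝ≥0∞} (hW : Measurable[m] W)
    {f : F → ℝ≥0∞} (hf : Measurable f) :
    ∫⁻ ω, W ω * ∫⁻ y in A, f y ∂empirical A (t + 2) (fun i => X i ω) ∂P =
      ∫⁻ ω, W ω * ∫⁻ y in A, f y ∂κ ω ∂P := by
  have ht : ((t + 1 : ℕ) : ℝ≥0∞)⁻¹ * (t + 1 : ℕ) = 1 := ENNReal.inv_mul_cancel (by simp) (by simp)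
  refine Eq.trans (lintegral_congr fun ω => ?_) ((h.lintegral_mul_tsum hW hA hf measurable_one
    (t + 1) fun j => ((t + 1 : ℕ) : ℝ≥0∞)⁻¹ * (j : ℝ≥0∞)⁻¹).trans (lintegral_congr_ae ?_))
  · congr 1
    have := setLIntegral_empirical_pow 1 one_ne_zero hA (t + 1) (fun i => X i ω) hf
    rw [pow_one] at this
    refine this.trans (tsum_congr fun j => ?_)
    by_cases hx : (fun i => X i ω) ∈ stopSet A (t + 1) j
    · rw [Set.indicator_of_mem hx, sum_indicator_one_of_mem_stopSet hx, Pi.one_apply, pow_one,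
        one_mul, one_mul]
      calc _ = (((t + 1 : ℕ) : ℝ≥0∞)⁻¹ * (t + 1 : ℕ)) *
            ((j : ℝ≥0∞)⁻¹ * ∑ a ∈ Finset.range j, A.indicator f (X a ω)) := by rw [ht, one_mul]
        _ = _ := by ring
    · simp [hx]
  · filter_upwards [hκ] with ω hω
    have hq : κ ω A ≠ ∞ := ne_top_of_le_ne_top ENNReal.one_ne_top (hω.2 ▸ le_self_add)
    have hpow : κ ω A ^ (t + 1) ≠ ∞ := ENNReal.pow_ne_top hq
    congr 1
    have : ∀ j : ℕ, ((t + 1 : ℕ) : ℝ≥0∞)⁻¹ * (j : ℝ≥0∞)⁻¹ *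
      (j.choose (t + 1) * (κ ω Aᶜ ^ (j - (t + 1)) *
        ((t + 1 : ℕ) * (κ ω A ^ (t + 1) * ∫⁻ y in A, f y * (1 : F → ℝ≥0∞) y ∂κ ω) +
        (t + 1 : ℕ) * (t + 1 - 1 : ℕ) * (κ ω A ^ (t + 1 - 1) *
          ((∫⁻ y in A, f y ∂κ ω) * ∫⁻ y in A, (1 : F → ℝ≥0∞) y ∂κ ω))))) =
        ((j : ℝ≥0∞)⁻¹ * (j.choose (t + 1) * (t + 1 : ℕ) * κ ω Aᶜ ^ (j - (t + 1)))) *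
          (κ ω A ^ (t + 1) * ∫⁻ y in A, f y ∂κ ω) := by
      intro j
      simp only [Pi.one_apply, mul_one, lintegral_const, Measure.restrict_apply_univ, one_mul,
        Nat.add_sub_cancel]
      calc _ = (((t + 1 : ℕ) : ℝ≥0∞)⁻¹ * (t + 1 : ℕ)) *
            (((j : ℝ≥0∞)⁻¹ * (j.choose (t + 1) * (t + 1 : ℕ) * κ ω Aᶜ ^ (j - (t + 1)))) *
          (κ ω A ^ (t + 1) * ∫⁻ y in A, f y ∂κ ω)) := by
              push_cast; ring
        _ = _ := by rw [ht, one_mul]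
    simp_rw [this]
    rw [ENNReal.tsum_mul_right, tsum_inv_mul_choose _ hω.1 hω.2, ← mul_assoc,
      ENNReal.inv_mul_cancel (pow_ne_zero _ hω.1) hpow, one_mul]

/-- With N = t+3, the N-1 diagonal pairs produce κ(f²) and the (N-1)(N-2) others κ(f)². Extracting
(N-1)(N-2) for the inverse-square series leaves 1/(N-2) on the diagonal. -/
theorem lintegral_mul_sq_setLIntegral_empirical_le (h : SampledFrom m P κ X)
    (hA : MeasurableSet A) (t : ℕ) (hκ : ∀ᵐ ω ∂P, κ ω A ≠ 0 ∧ κ ω A + κ ω Aᶜ = 1)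
    {W : Ω → ℝ≥0∞} (hW : Measurable[m] W) {f : F → ℝ≥0∞} (hf : Measurable f) :
    ∫⁻ ω, W ω * (∫⁻ y in A, f y ∂empirical A (t + 3) (fun i => X i ω)) ^ 2 ∂P ≤
      ∫⁻ ω, W ω * (((t + 1 : ℕ) : ℝ≥0∞)⁻¹ * (κ ω A * ∫⁻ y in A, f y * f y ∂κ ω) +
        (∫⁻ y in A, f y ∂κ ω) ^ 2) ∂P := by
  have ht : ((t + 1 : ℕ) : ℝ≥0∞)⁻¹ * (t + 1 : ℕ) = 1 := ENNReal.inv_mul_cancel (by simp) (by simp)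
  refine Eq.trans_le (lintegral_congr fun ω => ?_) ((h.lintegral_mul_tsum hW hA hf hf
    (t + 2) fun j => (j : ℝ≥0∞)⁻¹ ^ 2).trans_le (lintegral_mono_ae ?_))
  · congr 1
    refine (setLIntegral_empirical_pow 2 two_ne_zero hA (t + 2) (fun i => X i ω) hf).trans
      (tsum_congr fun j => ?_)
    ring
  · filter_upwards [hκ] with ω hω
    have hq : κ ω A ≠ ∞ := ne_top_of_le_ne_top ENNReal.one_ne_top (hω.2 ▸ le_self_add)
    have hpow : κ ω A ^ (t + 1) ≠ ∞ := ENNReal.pow_ne_top hq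
    gcongr
    set u := ∫⁻ y in A, f y * f y ∂κ ω
    set v := ∫⁻ y in A, f y ∂κ ω
    have : ∀ j : ℕ, (j : ℝ≥0∞)⁻¹ ^ 2 *
      (j.choose (t + 2) * (κ ω Aᶜ ^ (j - (t + 2)) *
        ((t + 2 : ℕ) * (κ ω A ^ (t + 2) * u) +
        (t + 2 : ℕ) * (t + 2 - 1 : ℕ) * (κ ω A ^ (t + 2 - 1) * (v * v))))) =
        ((j : ℝ≥0∞)⁻¹ ^ 2 *
          (j.choose (t + 2) * ((t + 2 : ℕ) * (t + 1 : ℕ)) * κ ω Aᶜ ^ (j - (t + 2)))) *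
          (κ ω A ^ (t + 1) * (((t + 1 : ℕ) : ℝ≥0∞)⁻¹ * (κ ω A * u) + v ^ 2)) := by
      intro j
      rw [show t + 2 - 1 = t + 1 by omega]
      calc _ = (j : ℝ≥0∞)⁻¹ ^ 2 *
            (j.choose (t + 2) * (κ ω Aᶜ ^ (j - (t + 2)) *
              ((t + 2 : ℕ) * (κ ω A ^ (t + 2) * u) * (((t + 1 : ℕ) : ℝ≥0∞)⁻¹ * (t + 1 : ℕ)) +
              (t + 2 : ℕ) * (t + 1 : ℕ) * (κ ω A ^ (t + 1) * (v * v))))) := by rw [ht, mul_one]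
        _ = _ := by ring
    simp_rw [this]
    rw [ENNReal.tsum_mul_right]
    calc _ ≤ (κ ω A ^ (t + 1))⁻¹ *
          (κ ω A ^ (t + 1) * (((t + 1 : ℕ) : ℝ≥0∞)⁻¹ * (κ ω A * u) + v ^ 2)) := by
          gcongr
          exact tsum_inv_sq_mul_choose_le t hω.1 hω.2
      _ = _ := by
          rw [← mul_assoc, ENNReal.inv_mul_cancel (pow_ne_zero _ hω.1) hpow, one_mul]

end SampledFrom

/-! ### Survival probabilities and their oscillation on the alive sets -/

section Survival

variable {E : ℕ → Type*} [∀ p, MeasurableSpace (E p)]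
  (M : ∀ p, Kernel (E p) (E (p + 1))) (B : ∀ p, Set (E p)) (x₀ : E 0)

/-- The probability that the chain started at time `p` is in `B` at the times
`p, …, p + k - 1`. -/
noncomputable def survive : (k p : ℕ) → E p → ℝ≥0∞
  | 0, _ => 1
  | k + 1, p => (B p).indicator fun x => ∫⁻ y, survive k (p + 1) y ∂M p x

theorem indicator_survive_succ (k p : ℕ) :
    (B p).indicator (survive M B (k + 1) p) = survive M B (k + 1) p := by
  rw [survive, Set.indicator_indicator, Set.inter_self]

theorem survive_succ_of_mem {k p : ℕ} {x : E p} (hx : x ∈ B p) :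
    survive M B (k + 1) p x = ∫⁻ y, survive M B k (p + 1) y ∂M p x := by
  rw [survive, Set.indicator_of_mem hx]

variable {B} in
theorem measurable_survive (hB : ∀ p, 1 ≤ p → MeasurableSet (B p)) :
    ∀ (k p : ℕ), 1 ≤ p → Measurable (survive M B k p)
  | 0, _, _ => measurable_one
  | k + 1, p, hp =>
    ((measurable_survive hB k (p + 1) (by omega)).lintegral_kernel).indicator (hB p hp)

variable {B} in
-- The Feynman-Kac semigroup property tested on 1: each step moves one potential and one kernel from
-- the measure to the function.
theorem gamma_add_univ (hB : ∀ p, 1 ≤ p → MeasurableSet (B p)) (k : ℕ) :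
    ∀ p, 1 ≤ p → gamma M B x₀ (p + k) Set.univ = ∫⁻ x, survive M B k p x ∂gamma M B x₀ p := by
  induction k with
  | zero => intro p _; simp [survive]
  | succ k ih =>
    intro p hp
    have hmeas := measurable_survive M hB k (p + 1) (by omega)
    rw [show p + (k + 1) = p + 1 + k by ring, ih (p + 1) (by omega)]
    obtain ⟨p, rfl⟩ := Nat.exists_eq_add_of_le' hp
    rw [gamma, Measure.lintegral_bind (M (p + 1)).measurable.aemeasurable hmeas.aemeasurable,
      survive, lintegral_indicator (hB _ hp)]

variable {M B} in
theorem hatDeltaProd_eq_prod_range (m p : ℕ) :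
    hatDeltaProd M B m p = ∏ q ∈ Finset.range m, hatDelta M B (p + q) := by
  rw [hatDeltaProd, Finset.prod_Ico_eq_prod_range]
  simp

variable [∀ p, IsMarkovKernel (M p)]

theorem survive_one (p : ℕ) : survive M B 1 p = (B p).indicator 1 := by
  ext x
  by_cases hx : x ∈ B p <;> simp [survive, hx]

variable {M B x₀}

theorem gamma_ne_zero_of_normConst_pos (hB : ∀ p, 1 ≤ p → MeasurableSet (B p))
    (hγ : ∀ p, 1 ≤ p → 0 < normConst M B x₀ p) {p : ℕ} (hp : 1 ≤ p) :
    gamma M B x₀ p (B p) ≠ 0 := by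
  have h := gamma_add_univ M x₀ hB 1 p hp
  rw [survive_one, lintegral_indicator_one (hB p hp)] at h
  rw [← h]
  intro h0
  have := hγ (p + 1) (by omega)
  rw [normConst, Measure.real, h0] at this
  simp at this

theorem hatDelta_spec (hB : ∀ p, 1 ≤ p → MeasurableSet (B p))
    (hγ : ∀ p, 1 ≤ p → 0 < normConst M B x₀ p) {p : ℕ} (hp : 1 ≤ p)
    (hδ : hatDelta M B p < ∞) :
    1 ≤ hatDelta M B p ∧ (∀ y ∈ B p, M p y (B (p + 1)) ≠ 0) ∧
      ∀ x ∈ B p, ∀ y ∈ B p, M p x (B (p + 1)) ≤ hatDelta M B p * M p y (B (p + 1)) := by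
  have hle : ∀ x ∈ B p, ∀ y ∈ B p, M p x (B (p + 1)) / M p y (B (p + 1)) ≤ hatDelta M B p :=
    fun x hx y hy => (le_iSup₂ (f := fun y (_ : y ∈ B p) =>
      M p x (B (p + 1)) / M p y (B (p + 1))) y hy).trans
        (le_iSup₂ (f := fun x (_ : x ∈ B p) => ⨆ y ∈ B p,
          M p x (B (p + 1)) / M p y (B (p + 1))) x hx)
  -- As 0/0 = 0, a finite supremum alone does not prevent the survival probability from vanishing on
  -- all of B_p; positivity of γ_{p+2}(1) does. Given one positive numerator, any zero denominator
  -- would make the supremum infinite.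
  obtain ⟨x, hx, hpos⟩ : ∃ x ∈ B p, M p x (B (p + 1)) ≠ 0 := by
    by_contra! hcon
    have h2 := gamma_add_univ M x₀ hB 2 p hp
    rw [survive, lintegral_indicator (hB p hp), setLIntegral_congr_fun (g := fun _ => 0) (hB p hp),
      lintegral_zero] at h2
    · have := hγ (p + 2) (by omega)
      rw [normConst, Measure.real, h2] at this
      simp at this
    · intro z hz
      simp only [survive_one]
      rw [lintegral_indicator_one (hB _ (by omega)), hcon z hz]
  have hne : ∀ y ∈ B p, M p y (B (p + 1)) ≠ 0 := fun y hy h0 => by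
    have := hle x hx y hy
    rw [h0, ENNReal.div_zero hpos] at this
    exact hδ.not_ge this
  refine ⟨?_, hne, fun x hx y hy => ?_⟩
  · rw [← ENNReal.div_self hpos (measure_ne_top _ _)]
    exact hle x hx x hx
  · exact (ENNReal.div_le_iff_le_mul (.inl (hne y hy)) (.inl (measure_ne_top _ _))).1 (hle x hx y hy)

section Mixing

variable (hB : ∀ p, 1 ≤ p → MeasurableSet (B p))
  (hne : ∀ p, 1 ≤ p → ∀ y ∈ B p, M p y (B (p + 1)) ≠ 0)
include hB

/-- Peels off the one-step survival probability and leaves an average under the conditioned kernel,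
the recursion behind the two bounds that follow. -/
theorem survive_add_two {k p : ℕ} (x : E p) (hx : x ∈ B p) (h0 : M p x (B (p + 1)) ≠ 0) :
    survive M B (k + 2) p x =
      M p x (B (p + 1)) * ∫⁻ y, survive M B (k + 1) (p + 1) y ∂hatM M B p x := by
  have hB' := hB (p + 1) (by omega)
  rw [survive_succ_of_mem M B hx, hatM_apply M B p hB', lintegral_smul_measure, smul_eq_mul,
    ← mul_assoc, ENNReal.mul_inv_cancel h0 (measure_ne_top _ _), one_mul,
    ← lintegral_indicator hB', indicator_survive_succ]

include hne

theorem hatMIter_spec {p : ℕ} (hp : 1 ≤ p) {x : E p} (hx : x ∈ B p) (i : ℕ) :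
    hatMIter M B p i x Set.univ = 1 ∧ ∀ᵐ z ∂hatMIter M B p i x, z ∈ B (p + i) := by
  induction i with
  | zero =>
    refine ⟨by simp [hatMIter], ?_⟩
    rw [hatMIter, Kernel.id_apply]
    exact (ae_dirac_iff (α := E p) (p := (· ∈ B p)) (hB p hp)).2 hx
  | succ i ih =>
    have hB' := hB (p + i + 1) (by omega)
    have hae : ∀ᵐ z ∂hatMIter M B p i x, hatM M B (p + i) z Set.univ = 1 ∧
        hatM M B (p + i) z (B (p + i + 1))ᶜ = 0 := by
      filter_upwards [ih.2] with z hz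
      rw [hatM_apply M B _ hB']
      simp only [Measure.smul_apply, Measure.restrict_apply_univ, smul_eq_mul,
        Measure.restrict_apply hB'.compl, Set.compl_inter_self, measure_empty, mul_zero, and_true]
      exact ENNReal.inv_mul_cancel (hne _ (by omega) z hz) (measure_ne_top _ _)
    constructor
    · rw [hatMIter, Kernel.comp_apply' _ _ _ .univ, lintegral_congr_ae (g := fun _ => 1), lintegral_one,
        ih.1]
      filter_upwards [hae] with z hz using hz.1
    · rw [ae_iff, hatMIter]
      change ((hatM M B (p + i) ∘ₖ hatMIter M B p i) x) (B (p + i + 1))ᶜ = 0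
      rw [Kernel.comp_apply' _ _ _ hB'.compl, lintegral_congr_ae (g := fun _ => 0), lintegral_zero]
      filter_upwards [hae] with z hz using hz.2

/-- Along the conditioned chain, each of the first i one-step survival probabilities is replaced by
its uniform bound. -/
theorem survive_le_prod_mul {b : ℕ → ℝ≥0∞} {p : ℕ} (hp : 1 ≤ p)
    (hb : ∀ q, p ≤ q → ∀ x ∈ B q, M q x (B (q + 1)) ≤ b q) (x : E p) (i : ℕ) :
    ∀ k, survive M B (i + (k + 1)) p x ≤ (∏ q ∈ Finset.range i, b (p + q)) *
      ∫⁻ z, survive M B (k + 1) (p + i) z ∂hatMIter M B p i x := by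
  induction i with
  | zero =>
    intro k
    have : ∫⁻ z, survive M B (k + 1) (p + 0) z ∂hatMIter M B p 0 x = survive M B (k + 1) p x :=
      lintegral_dirac' (α := E p) x (measurable_survive M hB _ _ hp)
    rw [this]
    simp
  | succ i ih =>
    intro k
    have hm := measurable_survive M hB (k + 1) (p + i + 1) (by omega)
    rw [show i + 1 + (k + 1) = i + (k + 1 + 1) by ring, hatMIter]
    refine (ih (k + 1)).trans ?_
    rw [Finset.prod_range_succ, mul_assoc]
    gcongr
    change _ ≤ b (p + i) * ∫⁻ z, survive M B (k + 1) (p + i + 1) z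
      ∂((hatM M B (p + i) ∘ₖ hatMIter M B p i) x)
    rw [Kernel.lintegral_comp _ _ _ hm, ← lintegral_const_mul _ hm.lintegral_kernel]
    refine lintegral_mono fun z => ?_
    by_cases hz : z ∈ B (p + i)
    · rw [survive_add_two hB z hz (hne _ (by omega) z hz)]
      gcongr
      exact hb _ (by omega) z hz
    · rw [← indicator_survive_succ, Set.indicator_of_notMem hz]
      exact zero_le

/-- The converse replacement costs δ per step. It is legitimate almost everywhere because the
conditioned chain stays in the alive sets. -/
theorem prod_mul_le_survive {b δ : ℕ → ℝ≥0∞} {p : ℕ} (hp : 1 ≤ p)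
    (hb : ∀ q, p ≤ q → ∀ x ∈ B q, b q ≤ δ q * M q x (B (q + 1))) {x : E p} (hx : x ∈ B p)
    (i : ℕ) : ∀ k, (∏ q ∈ Finset.range i, b (p + q)) *
        ∫⁻ z, survive M B (k + 1) (p + i) z ∂hatMIter M B p i x ≤
      (∏ q ∈ Finset.range i, δ (p + q)) * survive M B (i + (k + 1)) p x := by
  induction i with
  | zero =>
    intro k
    have : ∫⁻ z, survive M B (k + 1) (p + 0) z ∂hatMIter M B p 0 x = survive M B (k + 1) p x :=
      lintegral_dirac' (α := E p) x (measurable_survive M hB _ _ hp)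
    rw [this]
    simp
  | succ i ih =>
    intro k
    have hm := measurable_survive M hB (k + 1) (p + i + 1) (by omega)
    have hm2 := measurable_survive M hB (k + 2) (p + i) (by omega)
    rw [show i + 1 + (k + 1) = i + (k + 1 + 1) by ring, hatMIter]
    change _ * ∫⁻ z, survive M B (k + 1) (p + i + 1) z
      ∂((hatM M B (p + i) ∘ₖ hatMIter M B p i) x) ≤ _
    rw [Kernel.lintegral_comp _ _ _ hm, Finset.prod_range_succ, Finset.prod_range_succ, mul_assoc,
      ← lintegral_const_mul _ hm.lintegral_kernel]
    calc _ ≤ (∏ q ∈ Finset.range i, b (p + q)) *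
          ∫⁻ z, δ (p + i) * survive M B (k + 2) (p + i) z ∂hatMIter M B p i x := by
          refine mul_le_mul' le_rfl (lintegral_mono_ae ?_)
          filter_upwards [(hatMIter_spec hB hne hp hx i).2] with z hz
          rw [survive_add_two hB z hz (hne _ (by omega) z hz), ← mul_assoc]
          gcongr
          exact hb _ (by omega) z hz
      _ = δ (p + i) * ((∏ q ∈ Finset.range i, b (p + q)) *
          ∫⁻ z, survive M B (k + 1 + 1) (p + i) z ∂hatMIter M B p i x) := by
          rw [lintegral_const_mul _ hm2]; ring
      _ ≤ δ (p + i) * ((∏ q ∈ Finset.range i, δ (p + q)) *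
          survive M B (i + (k + 1 + 1)) p x) := by
          exact mul_le_mul' le_rfl (ih (k + 1))
      _ = _ := by ring

end Mixing

/-- Taking b_q as the supremum of the one-step survival probability on B_q, the same product of b's
bounds the value at x and is in turn bounded through the value at y. In between, the mixing
condition exchanges x for y at cost β̂; the return costs the product of the δ̂_q. -/
theorem survive_succ_le (hB : ∀ p, 1 ≤ p → MeasurableSet (B p))
    (hγ : ∀ p, 1 ≤ p → 0 < normConst M B x₀ p) {m : ℕ} {β : ℕ → ℝ} (hH : HatH M B m β)
    {p : ℕ} (hp : 1 ≤ p) (k : ℕ) {x y : E p} (hx : x ∈ B p) (hy : y ∈ B p) :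
    survive M B (k + 1) p x ≤
      hatDeltaProd M B m p * ENNReal.ofReal (β p) * survive M B (k + 1) p y := by
  have hspec := fun p hp => hatDelta_spec hB hγ hp (hH.delta_lt_top p hp)
  have hne := fun p hp => (hspec p hp).2.1
  set b : ℕ → ℝ≥0∞ := fun q => ⨆ x ∈ B q, M q x (B (q + 1))
  have hb1 : ∀ q, p ≤ q → ∀ x ∈ B q, M q x (B (q + 1)) ≤ b q := fun q _ x hx =>
    le_iSup₂ (f := fun x (_ : x ∈ B q) => M q x (B (q + 1))) x hx
  have hb2 : ∀ q, p ≤ q → ∀ x ∈ B q, b q ≤ hatDelta M B q * M q x (B (q + 1)) :=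
    fun q hq x hx => iSup₂_le fun y hy => (hspec q (by omega)).2.2 y hy x hx
  have hβ : 1 ≤ ENNReal.ofReal (β p) := by
    rw [← ENNReal.ofReal_one]
    exact ENNReal.ofReal_le_ofReal (hH.one_le_beta p hp)
  rw [hatDeltaProd_eq_prod_range]
  rcases le_or_gt m k with hmk | hmk
  · obtain ⟨j, rfl⟩ := Nat.exists_eq_add_of_le hmk
    rw [add_assoc]
    calc survive M B (m + (j + 1)) p x
        ≤ (∏ q ∈ Finset.range m, b (p + q)) *
          ∫⁻ z, survive M B (j + 1) (p + m) z ∂hatMIter M B p m x :=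
          survive_le_prod_mul hB hne hp hb1 x m j
      _ ≤ (∏ q ∈ Finset.range m, b (p + q)) *
          ∫⁻ z, survive M B (j + 1) (p + m) z ∂(ENNReal.ofReal (β p) • hatMIter M B p m y) := by
          gcongr
          exact hH.mixing p hp x hx y hy
      _ = ENNReal.ofReal (β p) * ((∏ q ∈ Finset.range m, b (p + q)) *
          ∫⁻ z, survive M B (j + 1) (p + m) z ∂hatMIter M B p m y) := by
          rw [lintegral_smul_measure, smul_eq_mul]; ring
      _ ≤ ENNReal.ofReal (β p) * ((∏ q ∈ Finset.range m, hatDelta M B (p + q)) *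
          survive M B (m + (j + 1)) p y) := by
          exact mul_le_mul' le_rfl (prod_mul_le_survive hB hne hp hb2 hy m j)
      _ = _ := by ring
  -- For horizons too short for m steps, only an indicator remains after k steps and its conditioned
  -- mean is 1, so no mixing is needed. The missing factors are all at least 1.
  · have hone : ∀ z ∈ B p,
        ∫⁻ w, survive M B (0 + 1) (p + k) w ∂hatMIter M B p k z = 1 := fun z hz => by
      have := hatMIter_spec hB hne hp hz k
      rw [lintegral_congr_ae (g := fun _ => 1), lintegral_one, this.1]
      filter_upwards [this.2] with w hw
      rw [zero_add, survive_one, Set.indicator_of_mem hw, Pi.one_apply]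
    have h1 := survive_le_prod_mul hB hne hp hb1 x k 0
    have h2 := prod_mul_le_survive hB hne hp hb2 hy k 0
    rw [hone x hx] at h1
    rw [hone y hy] at h2
    refine (h1.trans h2).trans ?_
    simp only [zero_add]
    rw [← mul_one (∏ q ∈ Finset.range k, hatDelta M B (p + q))]
    refine mul_le_mul' (mul_le_mul' ?_ hβ) le_rfl
    exact Finset.prod_le_prod_of_subset_of_one_le' (Finset.range_mono hmk.le)
      fun i _ _ => (hspec (p + i) (by omega)).1

end Survival

/-! ### Moment recursions for the alive filter -/

section Filter

variable {E : ℕ → Type*} [∀ p, MeasurableSpace (E p)]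

theorem lintegral_Phi {M : ∀ p, Kernel (E p) (E (p + 1))} {B : ∀ p, Set (E p)} (p : ℕ)
    (μ : Measure (E p)) {f : E (p + 1) → ℝ≥0∞} (hf : Measurable f) :
    ∫⁻ y, f y ∂Phi M B p μ = (μ (B p))⁻¹ * ∫⁻ x in B p, ∫⁻ y, f y ∂M p x ∂μ := by
  rw [Phi, lintegral_smul_measure, smul_eq_mul,
    Measure.lintegral_bind (M p).measurable.aemeasurable hf.aemeasurable]

theorem empirical_apply_ne {F : Type*} [MeasurableSpace F] {A : Set F} (hA : MeasurableSet A)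
    {t : ℕ} {x : ℕ → F} (hx : stopTime A (t + 2) x ≠ 0) :
    empirical A (t + 2) x A ≠ 0 ∧ empirical A (t + 2) x A ≠ ∞ ∧
      ((t + 1 : ℕ) : ℝ≥0∞) * ((stopTime A (t + 2) x - 1 : ℕ) : ℝ≥0∞)⁻¹ =
        empirical A (t + 2) x A := by
  obtain ⟨j, hj⟩ := Nat.exists_eq_succ_of_ne_zero hx
  have hmem := (stopTime_eq_succ_iff A (t + 1) j x).1 hj
  have hjpos : j ≠ 0 := by
    rintro rfl
    simp [stopSet] at hmem
  rw [empirical_apply hA hmem, hj, Nat.succ_sub_one, mul_comm (j : ℝ≥0∞)⁻¹]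
  refine ⟨mul_ne_zero (by simp) (by simp), ENNReal.mul_ne_top (by simp) (by simpa using hjpos), rfl⟩

/-- Integrating f(x) ≤ C f(y) over y ∈ A bounds μ(A) f(x) by C times the integral of f; multiplying
by f(x) and integrating again gives the claim. -/
theorem mul_setLIntegral_sq_le {F : Type*} [MeasurableSpace F] (μ : Measure F) {A : Set F}
    (hA : MeasurableSet A) {f : F → ℝ≥0∞} (hf : Measurable f) {C : ℝ≥0∞}
    (h : ∀ x ∈ A, ∀ y ∈ A, f x ≤ C * f y) :
    μ A * ∫⁻ x in A, f x * f x ∂μ ≤ C * (∫⁻ x in A, f x ∂μ) ^ 2 := by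
  rw [← lintegral_const_mul (f := fun x => f x * f x) _ (hf.mul hf)]
  calc ∫⁻ x in A, μ A * (f x * f x) ∂μ
      ≤ ∫⁻ x in A, (C * ∫⁻ y in A, f y ∂μ) * f x ∂μ := by
        refine setLIntegral_mono' hA fun x hx => ?_
        rw [← mul_assoc]
        refine mul_le_mul' ?_ le_rfl
        rw [mul_comm, ← setLIntegral_const, ← lintegral_const_mul _ hf]
        exact setLIntegral_mono' hA fun y hy => h x hx y hy
    _ = _ := by rw [lintegral_const_mul _ hf]; ring

variable (M : ∀ p, Kernel (E p) (E (p + 1))) (B : ∀ p, Set (E p)) (x₀ : E 0) (N : ℕ)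
  {Ω : Type*} (X : ∀ p, ℕ → Ω → E p)

/-- The conditional law of the particles at time `p + 1` given the particles up to time `p`. -/
noncomputable def particleLaw : (p : ℕ) → Ω → Measure (E (p + 1))
  | 0, _ => M 0 x₀
  | p + 1, ω => Phi M B (p + 1) (empirical (B (p + 1)) N fun i => X (p + 1) i ω)

/-- The estimate of the normalizing constant at time `p + 1`, as an extended nonnegative real. -/
noncomputable def weight (p : ℕ) (ω : Ω) : ℝ≥0∞ :=
  ∏ q ∈ Finset.range p, ((N - 1 : ℕ) : ℝ≥0∞) *
    ((stopTime (B (q + 1)) N (fun i => X (q + 1) i ω) - 1 : ℕ) : ℝ≥0∞)⁻¹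

theorem comap_le_history {q p : ℕ} (hq : 1 ≤ q) (hqp : q ≤ p) (i : ℕ) :
    MeasurableSpace.comap (X q i) inferInstance ≤ history X p :=
  le_trans (le_iSup (fun i : ℕ => MeasurableSpace.comap (X q i) inferInstance) i)
    (le_iSup₂ (f := fun q (_ : q ∈ Finset.Icc 1 p) =>
      ⨆ i : ℕ, MeasurableSpace.comap (X q i) inferInstance) q (Finset.mem_Icc.2 ⟨hq, hqp⟩))

theorem measurable_history {q p : ℕ} (hq : 1 ≤ q) (hqp : q ≤ p) :
    Measurable[history X p] fun ω i => X q i ω :=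
  letI := history X p
  measurable_pi_lambda _ fun i => Measurable.of_comap_le (comap_le_history X hq hqp i)

variable {M B x₀ X}

theorem measurable_particleLaw {t : ℕ} (hB : ∀ p, 1 ≤ p → MeasurableSet (B p)) (p : ℕ) :
    Measurable[history X p] (particleLaw M B x₀ (t + 2) X p) := by
  cases p with
  | zero => exact measurable_const
  | succ p =>
    have hBp := hB (p + 1) (by omega)
    refine Measure.measurable_of_measurable_coe _ fun C hC => ?_
    have h : ∀ x : ℕ → E (p + 1), Phi M B (p + 1) (empirical (B (p + 1)) (t + 2) x) C =
        (∫⁻ y in B (p + 1), (1 : E (p + 1) → ℝ≥0∞) y ∂empirical (B (p + 1)) (t + 2) x)⁻¹ *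
          ∫⁻ y in B (p + 1), M (p + 1) y C ∂empirical (B (p + 1)) (t + 2) x := fun x => by
      rw [← lintegral_indicator_one hC, lintegral_Phi _ _ (measurable_one.indicator hC)]
      simp [lintegral_indicator_one hC]
    simp only [particleLaw, h]
    exact ((measurable_setLIntegral_empirical hBp (t + 1) measurable_one).inv.mul
      (measurable_setLIntegral_empirical hBp (t + 1) ((M (p + 1)).measurable_coe hC))).comp
      (measurable_history X (by omega) le_rfl)

theorem measurable_weight {t : ℕ} (hB : ∀ p, 1 ≤ p → MeasurableSet (B p)) (p : ℕ) :
    Measurable[history X p] (weight B (t + 2) X p) := by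
  refine Finset.measurable_prod _ fun q hq => ?_
  have h := (measurable_stopTime (hB (q + 1) (by omega)) (t + 1)).comp
    (measurable_history X (p := p) (q := q + 1) (by omega) (by simpa using hq))
  exact (measurable_from_nat (f := fun k : ℕ => ((t + 2 - 1 : ℕ) : ℝ≥0∞) *
    ((k - 1 : ℕ) : ℝ≥0∞)⁻¹)).comp h

variable [m0 : MeasurableSpace Ω] {P : Measure Ω}

theorem history_le (hX : ∀ p, 1 ≤ p → ∀ i, Measurable (X p i)) (p : ℕ) : history X p ≤ m0 :=
  iSup₂_le fun q hq => iSup_le fun i => (hX q (Finset.mem_Icc.1 hq).1 i).comap_le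

variable [IsProbabilityMeasure P]

theorem IsAliveFilter.sampledFrom {t : ℕ} (hX : IsAliveFilter M B x₀ (t + 2) P X)
    (hB : ∀ p, 1 ≤ p → MeasurableSet (B p)) (p : ℕ) :
    SampledFrom (history X p) P (particleLaw M B x₀ (t + 2) X p) (X (p + 1)) where
  le := history_le hX.measurable p
  measurable_law := measurable_particleLaw hB p
  measurable := hX.measurable (p + 1) (by omega)
  measure_inter S hS k A hA := by
    cases p with
    | zero =>
      have hbot : history X 0 = ⊥ := by simp [history]
      rw [hbot] at hS
      rcases MeasurableSpace.measurableSet_bot_iff.1 hS with rfl | rfl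
      · simp
      · simp [particleLaw, ← hX.init k A hA]
    | succ p => exact hX.step (p + 1) (by omega) S hS k A hA

variable [∀ p, IsMarkovKernel (M p)]

section Moments

variable {t : ℕ} (hX : IsAliveFilter M B x₀ (t + 2) P X)
  (hB : ∀ p, 1 ≤ p → MeasurableSet (B p)) (h0 : M 0 x₀ (B 1) ≠ 0)
  (hne : ∀ p, 1 ≤ p → ∀ y ∈ B p, M p y (B (p + 1)) ≠ 0)
include hX hB h0 hne

/-- Induction in time: if the law charges the alive set, stopping occurs almost surely, so the
empirical measure charges that set. Then Φ yields a probability, which charges the next alive set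
because every alive point survives with positive probability. -/
theorem IsAliveFilter.ae_particleLaw (p : ℕ) :
    ∀ᵐ ω ∂P, particleLaw M B x₀ (t + 2) X p ω (B (p + 1)) ≠ 0 ∧
      particleLaw M B x₀ (t + 2) X p ω (B (p + 1)) +
        particleLaw M B x₀ (t + 2) X p ω (B (p + 1))ᶜ = 1 := by
  induction p with
  | zero =>
    refine Filter.Eventually.of_forall fun ω => ⟨h0, ?_⟩
    rw [measure_add_measure_compl (hB (0 + 1) le_rfl)]
    simp [particleLaw]
  | succ p ih =>
    have hBp := hB (p + 1) (by omega)
    have hBp' := hB (p + 1 + 1) (by omega)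
    filter_upwards [(hX.sampledFrom hB p).ae_stopTime_ne_zero hBp t ih] with ω hω
    obtain ⟨hq0, hqt, -⟩ := empirical_apply_ne hBp hω
    rw [measure_add_measure_compl hBp']
    have happ : ∀ C, MeasurableSet C → particleLaw M B x₀ (t + 2) X (p + 1) ω C =
        (empirical (B (p + 1)) (t + 2) (fun i => X (p + 1) i ω) (B (p + 1)))⁻¹ *
          ∫⁻ y in B (p + 1), M (p + 1) y C
            ∂empirical (B (p + 1)) (t + 2) (fun i => X (p + 1) i ω) := fun C hC => by
      rw [particleLaw, ← lintegral_indicator_one hC, lintegral_Phi _ _ (measurable_one.indicator hC)]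
      simp [lintegral_indicator_one hC]
    constructor
    · rw [happ _ hBp']
      refine mul_ne_zero (ENNReal.inv_ne_zero.2 hqt) ?_
      refine ((setLIntegral_pos_iff ((M (p + 1)).measurable_coe hBp')).2 ?_).ne'
      exact (pos_iff_ne_zero.2 hq0).trans_le
        (measure_mono fun z hz => ⟨hne (p + 1) (by omega) z hz, hz⟩)
    · rw [happ _ .univ]
      simp [ENNReal.inv_mul_cancel hq0 hqt]

theorem IsAliveFilter.ae_stopTime_ne_zero (p : ℕ) :
    ∀ᵐ ω ∂P, stopTime (B (p + 1)) (t + 2) (fun i => X (p + 1) i ω) ≠ 0 :=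
  (hX.sampledFrom hB p).ae_stopTime_ne_zero (hB (p + 1) (by omega)) t
    (hX.ae_particleLaw hB h0 hne p)

theorem IsAliveFilter.ae_weight_succ_mul (p k : ℕ) :
    ∀ᵐ ω ∂P, weight B (t + 2) X (p + 1) ω *
        ∫⁻ y, survive M B k (p + 2) y ∂particleLaw M B x₀ (t + 2) X (p + 1) ω =
      weight B (t + 2) X p ω * ∫⁻ y in B (p + 1), survive M B (k + 1) (p + 1) y
        ∂empirical (B (p + 1)) (t + 2) (fun i => X (p + 1) i ω) := by
  have hBp := hB (p + 1) (by omega)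
  filter_upwards [hX.ae_stopTime_ne_zero hB h0 hne p] with ω hω
  obtain ⟨hq0, hqt, hq⟩ := empirical_apply_ne hBp hω
  rw [weight, Finset.prod_range_succ, ← weight, show t + 2 - 1 = t + 1 from rfl, hq, particleLaw,
    lintegral_Phi _ _ (measurable_survive M hB k (p + 2) (by omega)), mul_assoc,
    ← mul_assoc (empirical _ _ _ _), ENNReal.mul_inv_cancel hq0 hqt, one_mul]
  congr 1
  exact setLIntegral_congr_fun hBp fun z hz => (survive_succ_of_mem M B hz).symm

/-- Each step back in time lengthens the survival horizon by one, so p + k is conserved down to p =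
0, where the law is deterministic. -/
theorem IsAliveFilter.lintegral_weight_mul (p : ℕ) :
    ∀ k, ∫⁻ ω, weight B (t + 2) X p ω *
        ∫⁻ y, survive M B k (p + 1) y ∂particleLaw M B x₀ (t + 2) X p ω ∂P =
      gamma M B x₀ (1 + (p + k)) Set.univ := by
  induction p with
  | zero =>
    intro k
    rw [gamma_add_univ M x₀ hB _ 1 le_rfl]
    simp [weight, particleLaw, gamma]
  | succ p ih =>
    intro k
    have hBp := hB (p + 1) (by omega)
    rw [lintegral_congr_ae (hX.ae_weight_succ_mul hB h0 hne p k),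
      (hX.sampledFrom hB p).lintegral_mul_setLIntegral_empirical hBp t
        (hX.ae_particleLaw hB h0 hne p) (measurable_weight hB p)
        (measurable_survive M hB (k + 1) (p + 1) (by omega)),
      show 1 + (p + 1 + k) = 1 + (p + (k + 1)) by ring, ← ih (k + 1)]
    refine lintegral_congr fun ω => ?_
    rw [← lintegral_indicator hBp, indicator_survive_succ]

theorem IsAliveFilter.lintegral_weight (p : ℕ) :
    ∫⁻ ω, weight B (t + 2) X p ω ∂P = gamma M B x₀ (1 + p) Set.univ := by
  rw [← add_zero p, ← hX.lintegral_weight_mul hB h0 hne p 0]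
  refine lintegral_congr_ae ?_
  filter_upwards [hX.ae_particleLaw hB h0 hne p] with ω hω
  rw [measure_add_measure_compl (hB _ (by omega))] at hω
  simp [survive, hω.2]

end Moments

/-- The same backward recursion for squares. The second-moment bound and the oscillation of the
survival function make each step cost 1 + C/(N-2), where N = t+3. -/
theorem IsAliveFilter.lintegral_sq_weight_mul_le {t : ℕ}
    (hX : IsAliveFilter M B x₀ (t + 3) P X)
    (hB : ∀ p, 1 ≤ p → MeasurableSet (B p)) (h0 : M 0 x₀ (B 1) ≠ 0)
    (hne : ∀ p, 1 ≤ p → ∀ y ∈ B p, M p y (B (p + 1)) ≠ 0) {C : ℕ → ℝ≥0∞}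
    (hC : ∀ p, 1 ≤ p → ∀ k, ∀ x ∈ B p, ∀ y ∈ B p,
      survive M B (k + 1) p x ≤ C p * survive M B (k + 1) p y) (p : ℕ) :
    ∀ k, ∫⁻ ω, (weight B (t + 3) X p ω *
        ∫⁻ y, survive M B k (p + 1) y ∂particleLaw M B x₀ (t + 3) X p ω) ^ 2 ∂P ≤
      (∏ q ∈ Finset.range p, (1 + ((t + 1 : ℕ) : ℝ≥0∞)⁻¹ * C (q + 1))) *
        gamma M B x₀ (1 + (p + k)) Set.univ ^ 2 := by
  induction p with
  | zero =>
    intro k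
    rw [gamma_add_univ M x₀ hB _ 1 le_rfl]
    simp [weight, particleLaw, gamma]
  | succ p ih =>
    intro k
    have hBp := hB (p + 1) (by omega)
    have hs := measurable_survive M hB (k + 1) (p + 1) (by omega)
    have hmW : Measurable (weight B (t + 3) X p) :=
      (measurable_weight (t := t + 1) hB p).mono (history_le hX.measurable p) le_rfl
    have hsamp := hX.sampledFrom (t := t + 1) hB p
    calc ∫⁻ ω, (weight B (t + 3) X (p + 1) ω *
          ∫⁻ y, survive M B k (p + 2) y ∂particleLaw M B x₀ (t + 3) X (p + 1) ω) ^ 2 ∂P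
        = ∫⁻ ω, weight B (t + 3) X p ω ^ 2 * (∫⁻ y in B (p + 1), survive M B (k + 1) (p + 1) y
            ∂empirical (B (p + 1)) (t + 3) (fun i => X (p + 1) i ω)) ^ 2 ∂P := by
          refine lintegral_congr_ae ?_
          filter_upwards [hX.ae_weight_succ_mul (t := t + 1) hB h0 hne p k] with ω hω
          rw [← mul_pow]
          exact congrArg (· ^ 2) hω
      _ ≤ _ := hsamp.lintegral_mul_sq_setLIntegral_empirical_le hBp t
            (hX.ae_particleLaw (t := t + 1) hB h0 hne p)
            ((measurable_weight (t := t + 1) hB p).pow_const 2) hs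
      _ ≤ ∫⁻ ω, (1 + ((t + 1 : ℕ) : ℝ≥0∞)⁻¹ * C (p + 1)) * (weight B (t + 3) X p ω *
            ∫⁻ y, survive M B (k + 1) (p + 1) y ∂particleLaw M B x₀ (t + 3) X p ω) ^ 2 ∂P := by
          refine lintegral_mono fun ω => ?_
          have hle := mul_setLIntegral_sq_le (particleLaw M B x₀ (t + 3) X p ω) hBp hs
            (hC (p + 1) (by omega) k)
          have hfull : ∫⁻ y in B (p + 1), survive M B (k + 1) (p + 1) y
              ∂particleLaw M B x₀ (t + 3) X p ω =
              ∫⁻ y, survive M B (k + 1) (p + 1) y ∂particleLaw M B x₀ (t + 3) X p ω := by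
            rw [← lintegral_indicator hBp, indicator_survive_succ]
          rw [hfull] at hle
          simp only
          rw [show t + 1 + 2 = t + 3 by ring, hfull]
          calc _ ≤ weight B (t + 3) X p ω ^ 2 * (((t + 1 : ℕ) : ℝ≥0∞)⁻¹ * (C (p + 1) *
                (∫⁻ y, survive M B (k + 1) (p + 1) y ∂particleLaw M B x₀ (t + 3) X p ω) ^ 2) +
                (∫⁻ y, survive M B (k + 1) (p + 1) y
                  ∂particleLaw M B x₀ (t + 3) X p ω) ^ 2) := by gcongr
            _ = _ := by ring
      _ = (1 + ((t + 1 : ℕ) : ℝ≥0∞)⁻¹ * C (p + 1)) * ∫⁻ ω, (weight B (t + 3) X p ω *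
            ∫⁻ y, survive M B (k + 1) (p + 1) y ∂particleLaw M B x₀ (t + 3) X p ω) ^ 2 ∂P :=
          lintegral_const_mul _ ((hmW.mul (hsamp.measurable_lintegral hs)).pow_const 2)
      _ ≤ (1 + ((t + 1 : ℕ) : ℝ≥0∞)⁻¹ * C (p + 1)) *
            ((∏ q ∈ Finset.range p, (1 + ((t + 1 : ℕ) : ℝ≥0∞)⁻¹ * C (q + 1))) *
              gamma M B x₀ (1 + (p + (k + 1))) Set.univ ^ 2) := by
          gcongr
          exact ih (k + 1)
      _ = _ := by
          rw [Finset.prod_range_succ, show 1 + (p + 1 + k) = 1 + (p + (k + 1)) by ring]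
          ring

theorem IsAliveFilter.lintegral_sq_weight_le {t : ℕ}
    (hX : IsAliveFilter M B x₀ (t + 3) P X)
    (hB : ∀ p, 1 ≤ p → MeasurableSet (B p)) (h0 : M 0 x₀ (B 1) ≠ 0)
    (hne : ∀ p, 1 ≤ p → ∀ y ∈ B p, M p y (B (p + 1)) ≠ 0) {C : ℕ → ℝ≥0∞}
    (hC : ∀ p, 1 ≤ p → ∀ k, ∀ x ∈ B p, ∀ y ∈ B p,
      survive M B (k + 1) p x ≤ C p * survive M B (k + 1) p y) (p : ℕ) :
    ∫⁻ ω, weight B (t + 3) X p ω ^ 2 ∂P ≤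
      (∏ q ∈ Finset.range p, (1 + ((t + 1 : ℕ) : ℝ≥0∞)⁻¹ * C (q + 1))) *
        gamma M B x₀ (1 + p) Set.univ ^ 2 := by
  refine le_of_eq_of_le (lintegral_congr_ae ?_) (hX.lintegral_sq_weight_mul_le hB h0 hne hC p 0)
  filter_upwards [hX.ae_particleLaw (t := t + 1) hB h0 hne p] with ω hω
  rw [measure_add_measure_compl (hB _ (by omega))] at hω
  have : particleLaw M B x₀ (t + 3) X p ω Set.univ = 1 := hω.2
  simp [survive, this]

end Filter

/-! ### Elementary inequalities for the constant 4 -/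

/-- By convexity exp lies below its chord on [0, 3/2], whose slope is at most (9/2 - 1)/(3/2) = 7/3
because e³ ≤ 81/4. -/
theorem exp_le_one_add_seven_thirds_mul {v : ℝ} (h0 : 0 ≤ v) (h1 : v ≤ 3 / 2) :
    Real.exp v ≤ 1 + 7 / 3 * v := by
  have hconv := convexOn_exp.right (Set.mem_univ 0) (Set.mem_univ (3 / 2 : ℝ))
    (show 0 ≤ 1 - 2 / 3 * v by linarith) (show 0 ≤ 2 / 3 * v by linarith) (by ring)
  simp only [smul_eq_mul, mul_zero, zero_add, Real.exp_zero, mul_one] at hconv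
  rw [show 2 / 3 * v * (3 / 2) = v by ring] at hconv
  have hexp : Real.exp (3 / 2) ≤ 9 / 2 := by
    refine le_of_sq_le_sq ?_ (by norm_num)
    rw [← Real.exp_nat_mul, show ((2 : ℕ) : ℝ) * (3 / 2) = (3 : ℕ) * 1 by norm_num, Real.exp_nat_mul]
    calc Real.exp 1 ^ 3 ≤ 2.7182818286 ^ 3 := by
          gcongr
          exact Real.exp_one_lt_d9.le
      _ ≤ _ := by norm_num
  nlinarith

/-- Here N = t+3 and n = p+1. The product has one factor fewer than the sum has terms, and the spare
term is at least 1; the resulting u ≤ S - 1 compensates for N-2 in place of N. -/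
theorem prod_one_add_div_sub_one_le {a c : ℕ → ℝ} {p t : ℕ} (hp : 1 ≤ p)
    (ha : ∀ s, 1 ≤ s → 1 ≤ a s) (hac : ∀ s, 1 ≤ s → a s ≤ c s)
    (hS : ∑ s ∈ Finset.Icc 1 (p + 1), c s < t + 3) :
    ∏ q ∈ Finset.range p, (1 + ((t : ℝ) + 1)⁻¹ * a (q + 1)) - 1 ≤
      4 / ((t : ℝ) + 3) * ∑ s ∈ Finset.Icc 1 (p + 1), c s := by
  set S := ∑ s ∈ Finset.Icc 1 (p + 1), c s with hSdef
  have hSeq : S = ∑ q ∈ Finset.range p, c (q + 1) + c (p + 1) := by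
    rw [hSdef, ← Finset.sum_range_succ, Finset.range_eq_Ico, Finset.sum_Ico_add' c 0 (p + 1) 1]
    rfl
  have hlast : 1 ≤ c (p + 1) := (ha _ (by omega)).trans (hac _ (by omega))
  set u := ∑ q ∈ Finset.range p, a (q + 1) with hu
  have huS : u + 1 ≤ S := by
    rw [hSeq]
    exact add_le_add (Finset.sum_le_sum fun q _ => hac _ (by omega)) hlast
  have hpu : (p : ℝ) ≤ u := by
    calc (p : ℝ) = ∑ q ∈ Finset.range p, (1 : ℝ) := by simp
      _ ≤ u := Finset.sum_le_sum fun q _ => ha _ (by omega)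
  have hu0 : 0 ≤ u := (Nat.cast_nonneg p).trans hpu
  -- For N = 3 the exponent is only known to be below 2, outside the range of the chord bound. But p
  -- ≤ u < 2 then leaves a single factor, which is handled directly.
  rcases Nat.eq_zero_or_pos t with rfl | ht
  · have hp1 : p = 1 := by
      have : (p : ℝ) < 2 := by push_cast at hS; linarith
      have : p < 2 := by exact_mod_cast this
      omega
    subst hp1
    simp only [hu, Finset.range_one, Finset.sum_singleton, zero_add] at huS
    simp
    linarith [ha 1 le_rfl]
  · have ht1 : (1 : ℝ) ≤ t := by exact_mod_cast ht
    have ht0 : (0 : ℝ) < t + 1 := by linarith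
    -- Since u ≤ S - 1 < t+2, the ratio is below (t+2)/(t+1), which is at most 3/2 for t ≥ 1.
    have hv : ((t : ℝ) + 1)⁻¹ * u ≤ 3 / 2 := by
      rw [inv_mul_le_iff₀ ht0]
      linarith
    have hprod : ∏ q ∈ Finset.range p, (1 + ((t : ℝ) + 1)⁻¹ * a (q + 1)) ≤
        Real.exp (((t : ℝ) + 1)⁻¹ * u) := by
      rw [hu, Finset.mul_sum, Real.exp_sum]
      refine Finset.prod_le_prod (fun q _ => ?_) fun q _ => ?_
      · have := ha (q + 1) (by omega)
        positivity
      · rw [add_comm]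
        exact Real.add_one_le_exp _
    have hexp := exp_le_one_add_seven_thirds_mul (by positivity) hv
    have hfin : 7 / 3 * (((t : ℝ) + 1)⁻¹ * u) ≤ 4 / ((t : ℝ) + 3) * S := by
      rw [show 7 / 3 * (((t : ℝ) + 1)⁻¹ * u) = 7 * u / (3 * ((t : ℝ) + 1)) by field_simp,
        div_mul_eq_mul_div, div_le_div_iff₀ (by positivity) (by positivity)]
      -- This is what remains of 7u(t+3) ≤ 12S(t+1) after inserting u ≤ S - 1.
      have h9 : 9 * S ≤ 5 * S * t + 7 * t + 21 := by
        rcases Nat.lt_or_ge t 2 with h2 | h2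
        · have : t = 1 := by omega
          subst this
          push_cast at hS ⊢
          linarith
        · have h2' : (2 : ℝ) ≤ t := by exact_mod_cast h2
          nlinarith
      have hut : u * ((t : ℝ) + 3) ≤ (S - 1) * (t + 3) :=
        mul_le_mul_of_nonneg_right (by linarith) (by positivity)
      nlinarith
    linarith

/-! ### Passage to real numbers and conclusion -/

section Coefficients

variable {E : ℕ → Type*} [∀ p, MeasurableSpace (E p)]
  {M : ∀ p, Kernel (E p) (E (p + 1))} [∀ p, IsMarkovKernel (M p)]
  {B : ∀ p, Set (E p)} {x₀ : E 0}

/-- Every factor of the oscillation constant is finite and at least 1, and dividing by η_s(G_s) ∈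
(0, 1] can only enlarge it. -/
theorem coeff_spec (hB : ∀ p, 1 ≤ p → MeasurableSet (B p))
    (hγ : ∀ p, 1 ≤ p → 0 < normConst M B x₀ p) {m : ℕ} {β : ℕ → ℝ} (hH : HatH M B m β)
    {s : ℕ} (hs : 1 ≤ s) :
    1 ≤ (hatDeltaProd M B m s * ENNReal.ofReal (β s)).toReal ∧
      (hatDeltaProd M B m s * ENNReal.ofReal (β s)).toReal ≤ coeff M B x₀ m β s ∧
      hatDeltaProd M B m s * ENNReal.ofReal (β s) ≠ ∞ := by
  have hβ := hH.one_le_beta s hs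
  have hδt : hatDeltaProd M B m s ≠ ∞ := by
    rw [hatDeltaProd_eq_prod_range]
    exact ENNReal.prod_ne_top fun q _ => (hH.delta_lt_top (s + q) (by omega)).ne
  have hδ : 1 ≤ hatDeltaProd M B m s := by
    rw [hatDeltaProd_eq_prod_range]
    exact Finset.one_le_prod' fun q _ =>
      (hatDelta_spec hB hγ (by omega) (hH.delta_lt_top (s + q) (by omega))).1
  have hδr : 1 ≤ (hatDeltaProd M B m s).toReal := by
    rw [← ENNReal.toReal_one]
    exact ENNReal.toReal_mono hδt hδ
  have heq : (hatDeltaProd M B m s * ENNReal.ofReal (β s)).toReal =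
      (hatDeltaProd M B m s).toReal * β s := by
    rw [ENNReal.toReal_mul, ENNReal.toReal_ofReal (by linarith)]
  have hg0 := gamma_ne_zero_of_normConst_pos hB hγ hs
  have hgt : gamma M B x₀ s Set.univ ≠ ∞ := fun h => by
    have := hγ s hs
    rw [normConst, Measure.real, h] at this
    simp at this
  have hgle : gamma M B x₀ s (B s) ≤ gamma M B x₀ s Set.univ := measure_mono (Set.subset_univ _)
  have heta : (eta M B x₀ s).real (B s) =
      (gamma M B x₀ s (B s)).toReal / (gamma M B x₀ s Set.univ).toReal := by
    rw [eta, Measure.real, Measure.smul_apply, smul_eq_mul, ENNReal.toReal_mul,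
      ENNReal.toReal_inv, inv_mul_eq_div]
  have hpos : 0 < (gamma M B x₀ s (B s)).toReal :=
    ENNReal.toReal_pos hg0 (ne_top_of_le_ne_top hgt hgle)
  have hle := ENNReal.toReal_mono hgt hgle
  rw [heq]
  refine ⟨one_le_mul_of_one_le_of_one_le hδr hβ, ?_, ENNReal.mul_ne_top hδt ENNReal.ofReal_ne_top⟩
  rw [coeff, heta]
  exact le_div_self (by positivity) (div_pos hpos (hpos.trans_le hle))
    (div_le_one_of_le₀ hle ENNReal.toReal_nonneg)

variable {Ω : Type*} [MeasurableSpace Ω] {P : Measure Ω} [IsProbabilityMeasure P]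
  {X : ∀ p, ℕ → Ω → E p}

/-- The two sides treat the default value T = 0 differently (truncated against real subtraction of
1), so agreement holds only off that null event. -/
theorem IsAliveFilter.ae_normConstEst_eq {t : ℕ} (hX : IsAliveFilter M B x₀ (t + 2) P X)
    (hB : ∀ p, 1 ≤ p → MeasurableSet (B p)) (h0 : M 0 x₀ (B 1) ≠ 0)
    (hne : ∀ p, 1 ≤ p → ∀ y ∈ B p, M p y (B (p + 1)) ≠ 0) (p : ℕ) :
    ∀ᵐ ω ∂P, normConstEst B (t + 2) X (p + 1) ω = (weight B (t + 2) X p ω).toReal := by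
  filter_upwards [ae_all_iff.2 fun q => hX.ae_stopTime_ne_zero hB h0 hne q] with ω hω
  rw [normConstEst, weight, ENNReal.toReal_prod, Finset.prod_Ico_eq_prod_range]
  refine Finset.prod_congr (by simp) fun q _ => ?_
  rw [add_comm 1 q, ENNReal.toReal_mul, ENNReal.toReal_inv, ENNReal.toReal_natCast,
    ENNReal.toReal_natCast, Nat.cast_sub (Nat.one_le_iff_ne_zero.2 (hω q)),
    Nat.cast_sub (by omega), div_eq_mul_inv, Nat.cast_one]

/-- Expand the square: unbiasedness turns the cross term into -2, leaving E[Y²]/g² - 1. -/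
theorem integral_sq_div_sub_one_le {Y : Ω → ℝ≥0∞} (hY : Measurable Y) {g K : ℝ≥0∞} (hg0 : g ≠ 0)
    (hgt : g ≠ ∞) (hK : K ≠ ∞) (h1 : ∫⁻ ω, Y ω ∂P = g) (h2 : ∫⁻ ω, Y ω ^ 2 ∂P ≤ K * g ^ 2) :
    Integrable (fun ω => ((Y ω).toReal / g.toReal - 1) ^ 2) P ∧
      ∫ ω, ((Y ω).toReal / g.toReal - 1) ^ 2 ∂P ≤ K.toReal - 1 := by
  have hKg : K * g ^ 2 ≠ ∞ := ENNReal.mul_ne_top hK (ENNReal.pow_ne_top hgt)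
  have hgpos : 0 < g.toReal := ENNReal.toReal_pos hg0 hgt
  have i1 : Integrable (fun ω => (Y ω).toReal) P :=
    integrable_toReal_of_lintegral_ne_top hY.aemeasurable (h1 ▸ hgt)
  have i2 : Integrable (fun ω => (Y ω).toReal ^ 2) P := by
    simp_rw [← ENNReal.toReal_pow]
    exact integrable_toReal_of_lintegral_ne_top (hY.pow_const 2).aemeasurable
      (ne_top_of_le_ne_top hKg h2)
  have e1 : ∫ ω, (Y ω).toReal ∂P = g.toReal := by
    rw [integral_toReal hY.aemeasurable (ae_lt_top hY (h1 ▸ hgt)), h1]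
  have e2 : ∫ ω, (Y ω).toReal ^ 2 ∂P ≤ K.toReal * g.toReal ^ 2 := by
    simp_rw [← ENNReal.toReal_pow]
    rw [integral_toReal (hY.pow_const 2).aemeasurable
      (ae_lt_top (hY.pow_const 2) (ne_top_of_le_ne_top hKg h2)), ← ENNReal.toReal_mul]
    exact ENNReal.toReal_mono hKg h2
  have hexp : (fun ω => ((Y ω).toReal / g.toReal - 1) ^ 2) = fun ω =>
      (g.toReal ^ 2)⁻¹ * (Y ω).toReal ^ 2 - 2 / g.toReal * (Y ω).toReal + 1 := by
    ext ω
    field_simp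
    ring
  have i3 := i2.const_mul (g.toReal ^ 2)⁻¹
  have i4 := i1.const_mul (2 / g.toReal)
  have i5 : Integrable (fun ω => (g.toReal ^ 2)⁻¹ * (Y ω).toReal ^ 2 -
    2 / g.toReal * (Y ω).toReal) P := i3.sub i4
  rw [hexp]
  refine ⟨i5.add (integrable_const 1), ?_⟩
  rw [integral_add i5 (integrable_const 1), integral_sub i3 i4, integral_const_mul,
    integral_const_mul, e1, integral_const, probReal_univ, one_smul, div_mul_cancel₀ _ hgpos.ne']
  have : (g.toReal ^ 2)⁻¹ * ∫ ω, (Y ω).toReal ^ 2 ∂P ≤ K.toReal := by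
    rw [inv_mul_le_iff₀ (by positivity), mul_comm]
    exact e2
  linarith

theorem IsAliveFilter.relative_variance_le {m : ℕ} {β : ℕ → ℝ} {n N : ℕ}
    (hX : IsAliveFilter M B x₀ N P X) (hB : ∀ p, 1 ≤ p → MeasurableSet (B p))
    (hγ : ∀ p, 1 ≤ p → 0 < normConst M B x₀ p) (hH : HatH M B m β) (hn : 2 ≤ n) (hN : 3 ≤ N)
    (hS : ∑ s ∈ Finset.Icc 1 n, coeff M B x₀ m β s < (N : ℝ)) :
    Integrable (fun ω => (normConstEst B N X n ω / normConst M B x₀ n - 1) ^ 2) P ∧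
      ∫ ω, (normConstEst B N X n ω / normConst M B x₀ n - 1) ^ 2 ∂P ≤
        4 / (N : ℝ) * ∑ s ∈ Finset.Icc 1 n, coeff M B x₀ m β s := by
  obtain ⟨t, rfl⟩ := Nat.exists_eq_add_of_le' hN
  obtain ⟨p, rfl⟩ := Nat.exists_eq_add_of_le' (show 1 ≤ n by omega)
  have hp : 1 ≤ p := by omega
  set C : ℕ → ℝ≥0∞ := fun s => hatDeltaProd M B m s * ENNReal.ofReal (β s)
  have hC := fun s hs => coeff_spec (x₀ := x₀) hB hγ hH (s := s) hs
  have hne := fun p hp => (hatDelta_spec hB hγ hp (hH.delta_lt_top p hp)).2.1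
  have h0 : M 0 x₀ (B 1) ≠ 0 := gamma_ne_zero_of_normConst_pos hB hγ le_rfl
  set g := gamma M B x₀ (1 + p) Set.univ with hg
  have hnc : normConst M B x₀ (p + 1) = g.toReal := by rw [hg, add_comm 1 p]; rfl
  have hgpos : 0 < g.toReal := hnc ▸ hγ (p + 1) (by omega)
  have hgne := ENNReal.toReal_pos_iff.1 hgpos
  set K := ∏ q ∈ Finset.range p, (1 + ((t + 1 : ℕ) : ℝ≥0∞)⁻¹ * C (q + 1)) with hK
  have hterm : ∀ q, ((t + 1 : ℕ) : ℝ≥0∞)⁻¹ * C (q + 1) ≠ ∞ := fun q =>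
    ENNReal.mul_ne_top (by simp) (hC (q + 1) (by omega)).2.2
  have hKt : K ≠ ∞ := ENNReal.prod_ne_top fun q _ =>
    ENNReal.add_ne_top.2 ⟨ENNReal.one_ne_top, hterm q⟩
  have hKr : K.toReal = ∏ q ∈ Finset.range p, (1 + ((t : ℝ) + 1)⁻¹ * (C (q + 1)).toReal) := by
    rw [hK, ENNReal.toReal_prod]
    refine Finset.prod_congr rfl fun q _ => ?_
    rw [ENNReal.toReal_add ENNReal.one_ne_top (hterm q), ENNReal.toReal_mul, ENNReal.toReal_inv,
      ENNReal.toReal_natCast, ENNReal.toReal_one, Nat.cast_add_one]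
  have hbound := integral_sq_div_sub_one_le (P := P) (Y := weight B (t + 3) X p)
    ((measurable_weight (t := t + 1) hB p).mono (history_le hX.measurable p) le_rfl)
    hgne.1.ne' hgne.2.ne hKt (hX.lintegral_weight (t := t + 1) hB h0 hne p)
    (hX.lintegral_sq_weight_le hB h0 hne
      (fun s hs k x hx y hy => survive_succ_le hB hγ hH hs k hx hy) p)
  have hae : (fun ω => ((weight B (t + 3) X p ω).toReal / g.toReal - 1) ^ 2) =ᵐ[P]
      fun ω => (normConstEst B (t + 3) X (p + 1) ω / normConst M B x₀ (p + 1) - 1) ^ 2 := by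
    have hest := hX.ae_normConstEst_eq (t := t + 1) hB h0 hne p
    rw [show t + 1 + 2 = t + 3 from rfl] at hest
    filter_upwards [hest] with ω hω
    rw [hnc, hω]
  refine ⟨hbound.1.congr hae, (integral_congr_ae hae).symm.trans_le (hbound.2.trans ?_)⟩
  rw [Nat.cast_add, Nat.cast_ofNat] at hS ⊢
  rw [hKr]
  exact prod_one_add_div_sub_one_le (a := fun s => (C s).toReal) (c := coeff M B x₀ m β) hp
    (fun s hs => (hC s hs).1) (fun s hs => (hC s hs).2.1) hS

end Coefficients

end AliveFilter

theorem proposition2 {E : ℕ → Type*} [∀ p, MeasurableSpace (E p)]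
    (M : ∀ p, Kernel (E p) (E (p + 1))) [∀ p, IsMarkovKernel (M p)]
    (B : ∀ p, Set (E p)) (hB : ∀ p, 1 ≤ p → MeasurableSet (B p)) (x₀ : E 0)
    (hγ : ∀ p, 1 ≤ p → 0 < AliveFilter.normConst M B x₀ p)
    (m : ℕ) (β : ℕ → ℝ) (hH : AliveFilter.HatH M B m β) :
    (∀ n N : ℕ, 2 ≤ n → 3 ≤ N →
      ∑ s ∈ Finset.Icc 1 n, AliveFilter.coeff M B x₀ m β s < (N : ℝ) →
      ∀ {Ω : Type*} [MeasurableSpace Ω] (P : Measure Ω) [IsProbabilityMeasure P]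
        (X : ∀ p, ℕ → Ω → E p), AliveFilter.IsAliveFilter M B x₀ N P X →
        Integrable (fun ω => (AliveFilter.normConstEst B N X n ω /
          AliveFilter.normConst M B x₀ n - 1) ^ 2) P ∧
        ∫ ω, (AliveFilter.normConstEst B N X n ω /
          AliveFilter.normConst M B x₀ n - 1) ^ 2 ∂P ≤
          4 / (N : ℝ) * ∑ s ∈ Finset.Icc 1 n, AliveFilter.coeff M B x₀ m β s) ∧
    (∀ c : ℝ, (∀ s, 1 ≤ s → AliveFilter.coeff M B x₀ m β s ≤ c) →
      ∀ n N : ℕ, 2 ≤ n → 3 ≤ N → c * n < (N : ℝ) →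
      ∀ {Ω : Type*} [MeasurableSpace Ω] (P : Measure Ω) [IsProbabilityMeasure P]
        (X : ∀ p, ℕ → Ω → E p), AliveFilter.IsAliveFilter M B x₀ N P X →
        ∫ ω, (AliveFilter.normConstEst B N X n ω /
          AliveFilter.normConst M B x₀ n - 1) ^ 2 ∂P ≤ 4) := by
  refine ⟨fun n N hn hN hS Ω _ P _ X hX => hX.relative_variance_le hB hγ hH hn hN hS,
    fun c hc n N hn hN hcN Ω _ P _ X hX => ?_⟩
  have hS : ∑ s ∈ Finset.Icc 1 n, AliveFilter.coeff M B x₀ m β s < (N : ℝ) := by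
    refine lt_of_le_of_lt ?_ hcN
    calc _ ≤ ∑ _s ∈ Finset.Icc 1 n, c := Finset.sum_le_sum fun s hs => hc s (Finset.mem_Icc.1 hs).1
      _ = c * n := by simp [mul_comm]
  have hN0 : (0 : ℝ) < N := by exact_mod_cast (by omega : 0 < N)
  refine (hX.relative_variance_le hB hγ hH hn hN hS).2.trans ?_
  rw [div_mul_eq_mul_div, div_le_iff₀ hN0]
  linarith
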